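/- Let $n,k\ge 0$, let $M\subseteq\mathbb R^n$ be open and connected, and let $H$ be a distribution on $M$ (a linear subspace $H_x\subseteq T_xM=\mathbb R^n$ for each $x\in M$) spanned by smooth vector fields $X_1,\dots,X_k$ on $M$, i.e. $H_x=\operatorname{span}\{X_1(x),\dots,X_k(x)\}$ for all $x\in M$. Assume that there are constants $K,L$ with $\|X_i(x)\|\le K$ and $\|X_i(x)-X_i(y)\|\le L\|x-y\|$ for all $i$ and all $x,y\in M$. Assume that $H$ is bracket generating: if $\mathcal V$ is the set of all smooth vector fields $V$ defined on open subsets of $M$ with $V(y)\in H_y$ wherever $V$ is defined, and $\mathcal L(\mathcal V)$ is the smallest set of local vector fields that contains $\mathcal V$ and is closed under Lie brackets (the bracket of two local vector fields being defined on the intersection of their domains), then for every $x\in M$ the values at $x$ of the members of $\mathcal L(\mathcal V)$ defined at $x$ span $\mathbb R^n$. Fix $x\in M$. Let $D_x\subseteq L^1([0,1];\mathbb R^k)$ be the set of controls $u=(u_1,\dots,u_k)$ for which there is an absolutely continuous curve $\gamma:[0,1]\to M$ with $\gamma(0)=x$ and $\dot\gamma(t)=\sum_{i=1}^k u_i(t)X_i(\gamma(t))$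 for almost every $t\in[0,1]$. Then $D_x$ is open, $0\in D_x$, and for each $u\in D_x$ the curve $\gamma$ is unique; so the endpoint map $\operatorname{End}_x:D_x\to M$, $\operatorname{End}_x(u)=\gamma(1)$, is well defined. It is Fréchet differentiable at every $u \in D_x$. Moreover, for every open set $U$ with $0\in U\subseteq D_x$ (in particular for $U=D_x$), the restricted endpoint map $$\operatorname{End}_x: L^1([0,1];\mathbb R^k)\supseteq U\to M$$ is open (it maps open sets to open sets), and its maximal rank $\max_{u\in U}\dim \operatorname{End}_x'(u)\bigl(L^1([0,1];\mathbb R^k)\bigr)$ equals $\dim M=n$. -/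

import Mathlib

open scoped ContDiff

namespace SubRiem

/-- Euclidean space `ℝⁿ`. -/
abbrev Rn (n : ℕ) : Type := EuclideanSpace ℝ (Fin n)

/-! ### Local vector fields, distributions and the bracket generating condition -/

/-- A smooth vector field defined on an open subset `dom` of `M ⊆ ℝⁿ` (`dom` may be empty).
The values of `toFun` outside `dom` are irrelevant. -/
structure LocalVectorField {n : ℕ} (M : Set (Rn n)) where
  dom : Set (Rn n)
  isOpen_dom : IsOpen dom
  dom_subset : dom ⊆ M
  toFun : Rn n → Rn n
  smooth : ContDiffOn ℝ ∞ toFun dom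

/-- The Lie bracket `[V, W] = DW·V - DV·W` of two local vector fields, defined on the
intersection of their domains. -/
noncomputable def LocalVectorField.bracket {n : ℕ} {M : Set (Rn n)}
    (V W : LocalVectorField M) : LocalVectorField M where
  dom := V.dom ∩ W.dom
  isOpen_dom := V.isOpen_dom.inter W.isOpen_dom
  dom_subset := fun _ hx => V.dom_subset hx.1
  toFun := VectorField.lieBracket ℝ V.toFun W.toFun
  smooth := fun _ hx =>
    (((V.smooth.contDiffAt (V.isOpen_dom.mem_nhds hx.1)).lieBracket_vectorField
      (W.smooth.contDiffAt (W.isOpen_dom.mem_nhds hx.2)) (by simp))).contDiffWithinAt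

/-- A set of local vector fields is involutive if it is closed under Lie brackets. -/
def IsInvolutive {n : ℕ} {M : Set (Rn n)} (𝒱 : Set (LocalVectorField M)) : Prop :=
  ∀ V ∈ 𝒱, ∀ W ∈ 𝒱, V.bracket W ∈ 𝒱

/-- The Lie hull: the smallest involutive set of local vector fields containing `𝒱`. -/
def lieHull {n : ℕ} {M : Set (Rn n)} (𝒱 : Set (LocalVectorField M)) :
    Set (LocalVectorField M) :=
  ⋂₀ {𝒲 | 𝒱 ⊆ 𝒲 ∧ IsInvolutive 𝒲}

/-- The linear hull of the values at `x` of the members of `𝒱` that are defined at `x`. -/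
def spanAt {n : ℕ} {M : Set (Rn n)} (𝒱 : Set (LocalVectorField M)) (x : Rn n) :
    Submodule ℝ (Rn n) :=
  Submodule.span ℝ {v | ∃ V ∈ 𝒱, x ∈ V.dom ∧ V.toFun x = v}

/-- The local vector fields that are horizontal for the distribution `H`, that is, whose value
at each point `x` of their domain lies in `H x`. -/
def horizontalFields {n : ℕ} (M : Set (Rn n)) (H : Rn n → Submodule ℝ (Rn n)) :
    Set (LocalVectorField M) :=
  {V | ∀ x ∈ V.dom, V.toFun x ∈ H x}

/-- The distribution `H` on `M` is bracket generating: the Lie hull of the set of all local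
horizontal vector fields spans the tangent space at each point of `M`. -/
def IsBracketGenerating {n : ℕ} (M : Set (Rn n)) (H : Rn n → Submodule ℝ (Rn n)) : Prop :=
  ∀ x ∈ M, spanAt (lieHull (horizontalFields M H)) x = ⊤

/-! ### Controlled curves and the endpoint map -/

/-- The Banach space `L¹([0,1]; ℝᵏ)` of controls. -/
abbrev Control (k : ℕ) : Type :=
  MeasureTheory.Lp (Rn k) 1 (MeasureTheory.volume.restrict (Set.Icc (0 : ℝ) 1))

/-- `γ : [0,1] → M` is a curve with initial value `x` controlled by `u`: it is absolutely
continuous, and `γ'(t) = ∑ᵢ uᵢ(t) Xᵢ(γ(t))` for almost every `t ∈ [0,1]`. Values of `γ`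
outside `[0,1]` are irrelevant. -/
structure IsControlledCurve {n k : ℕ} (M : Set (Rn n)) (X : Fin k → Rn n → Rn n)
    (u : Control k) (x : Rn n) (γ : ℝ → Rn n) : Prop where
  mem : ∀ t ∈ Set.Icc (0 : ℝ) 1, γ t ∈ M
  init : γ 0 = x
  absCont : AbsolutelyContinuousOnInterval γ 0 1
  deriv : ∀ᵐ t ∂(MeasureTheory.volume.restrict (Set.Icc (0 : ℝ) 1)),
    HasDerivAt γ (∑ i, u t i • X i (γ t)) t

/-- The domain of the endpoint map: the controls `u` for which the control equation with
initial value `x` has a solution in `M` on all of `[0,1]`. -/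
def endDomain {n k : ℕ} (M : Set (Rn n)) (X : Fin k → Rn n → Rn n) (x : Rn n) :
    Set (Control k) :=
  {u | ∃ γ, IsControlledCurve M X u x γ}

open Classical in
/-- The endpoint map `u ↦ γ(1)`, where `γ` is the curve starting at `x` controlled by `u`
(with the irrelevant value `x` outside `endDomain M X x`). -/
noncomputable def endMap {n k : ℕ} (M : Set (Rn n)) (X : Fin k → Rn n → Rn n) (x : Rn n)
    (u : Control k) : Rn n :=
  if h : ∃ γ, IsControlledCurve M X u x γ then h.choose 1 else x

/-- The rank of a map at `u`: the dimension of the image of its Fréchet derivative at `u`. -/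
noncomputable def rankAt {n k : ℕ} (f : Control k → Rn n) (u : Control k) : ℕ :=
  Module.finrank ℝ (LinearMap.range (fderiv ℝ f u).toLinearMap)

end SubRiem

/-!
The control equation is read as the fixed point equation
`η = x + ∫₀ᵗ ∑ᵢ uᵢ Xᵢ(η)` in the Banach space of continuous curves on `[0,1]`. Both the superposition
operator `η ↦ X ∘ η` (`contDiffOn_superpose`) and the bilinear operator `volterra` are smooth, and
the derivative in `η` has the form `1 - T` with a Volterra operator `T` with integrable kernel, hence
is invertible (`isInvertible_one_sub_of_norm_le_integral`). The implicit function theorem gives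
smooth dependence on the initial value and the control (`exists_contDiffAt_isSolution`): the domain
of the endpoint map is open and the endpoint map is smooth. Uniqueness is Grönwall's lemma.

Testing the variational equation with controls concentrated just before time `1` shows that the
image of the derivative of the endpoint map contains the distribution at the endpoint
(`span_le_range_fderiv_endMap`). Now take a control `u` at which the rank is maximal on a given open
set. On a finite-dimensional slice through `u` complementary to the kernel of the derivative, the
endpoint map is an immersion whose tangent spaces are the full images of its derivatives. All
horizontal fields are tangent to this immersed submanifold, and so are their iterated brackets
(`isInvolutive_tangentFields`). By the bracket generating condition the rank at `u` is `n`
(`exists_range_fderiv_endMap_eq_top`).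

Consequently every point `y` has a neighborhood of points that can be reached from `y` by controls
of small `L¹` norm (`eventually_reach`). Openness at an arbitrary, possibly singular, control `u`
follows because the `L¹` norm is invariant under reparametrization: cut `u` shortly before time `1`,
run through the remainder of its curve faster, and append a short curve to any point near the
endpoint. The resulting control is `L¹`-close to `u` (`exists_forall_reach_mem_image_endMap`).
-/

namespace SubRiem

open MeasureTheory Set Filter Topology

/-! ### Absolutely continuous primitives and Grönwall's lemma with an integrable kernel -/

theorem absolutelyContinuousOnInterval_of_dist_le {X Y : Type*} [PseudoMetricSpace X]
    [PseudoMetricSpace Y] {f : ℝ → X} {g : ℝ → Y} {a b : ℝ}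
    (hg : AbsolutelyContinuousOnInterval g a b)
    (h : ∀ s ∈ uIcc a b, ∀ t ∈ uIcc a b, dist (f s) (f t) ≤ dist (g s) (g t)) :
    AbsolutelyContinuousOnInterval f a b := by
  rw [absolutelyContinuousOnInterval_iff] at hg ⊢
  intro ε hε
  obtain ⟨δ, hδ, H⟩ := hg ε hε
  refine ⟨δ, hδ, fun E hE hlt => lt_of_le_of_lt (Finset.sum_le_sum fun i hi => ?_) (H E hE hlt)⟩
  have := hE.1 i hi
  exact h _ this.1 _ this.2

/-- Primitives of integrable functions are absolutely continuous, for values in any normed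
space. -/
theorem absolutelyContinuousOnInterval_primitive {E : Type*} [NormedAddCommGroup E]
    [NormedSpace ℝ E] {f : ℝ → E} {a b : ℝ} (hf : IntervalIntegrable f volume a b) :
    AbsolutelyContinuousOnInterval (fun t => ∫ s in a..t, f s) a b := by
  refine absolutelyContinuousOnInterval_of_dist_le
    (hf.norm.absolutelyContinuousOnInterval_intervalIntegral (c := a) (by simp)) ?_
  intro s hs t ht
  have h1 : ∀ r ∈ uIcc a b, IntervalIntegrable f volume a r := fun r hr =>
    hf.mono_set (uIcc_subset_uIcc_left hr)
  rw [dist_eq_norm, dist_eq_norm, intervalIntegral.integral_interval_sub_left (h1 s hs) (h1 t ht),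
    intervalIntegral.integral_interval_sub_left (h1 s hs).norm (h1 t ht).norm, Real.norm_eq_abs]
  exact intervalIntegral.norm_integral_le_abs_integral_norm

theorem absolutelyContinuousOnInterval_pow {f : ℝ → ℝ} {a b : ℝ}
    (hf : AbsolutelyContinuousOnInterval f a b) (N : ℕ) :
    AbsolutelyContinuousOnInterval (fun t => f t ^ N) a b := by
  induction N with
  | zero =>
    refine absolutelyContinuousOnInterval_of_dist_le hf fun s _ t _ => ?_
    simp
  | succ N ih => simpa only [pow_succ] using ih.fun_mul hf

theorem integral_mul_primitive_pow {a : ℝ → ℝ} (ha : IntervalIntegrable a volume 0 1) (N : ℕ)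
    {t : ℝ} (ht : t ∈ Icc (0 : ℝ) 1) :
    ∫ s in (0 : ℝ)..t, a s * (∫ r in (0 : ℝ)..s, a r) ^ N =
      (∫ r in (0 : ℝ)..t, a r) ^ (N + 1) / (N + 1) := by
  have hα : AbsolutelyContinuousOnInterval (fun t => ∫ r in (0 : ℝ)..t, a r) 0 1 :=
    absolutelyContinuousOnInterval_primitive ha
  have hint : IntervalIntegrable (fun s => a s * (∫ r in (0 : ℝ)..s, a r) ^ N) volume 0 1 :=
    ha.mul_continuousOn (hα.continuousOn.pow N)
  have hg : AbsolutelyContinuousOnInterval (fun t => ((N : ℝ) + 1)⁻¹ *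
      (∫ r in (0 : ℝ)..t, a r) ^ (N + 1) -
      ∫ s in (0 : ℝ)..t, a s * (∫ r in (0 : ℝ)..s, a r) ^ N) 0 1 :=
    ((absolutelyContinuousOnInterval_pow hα (N + 1)).const_mul _).fun_sub
      (absolutelyContinuousOnInterval_primitive hint)
  obtain ⟨C, hC⟩ := hg.const_of_ae_hasDerivAt_zero (by
    filter_upwards [ha.ae_hasDerivAt_integral, hint.ae_hasDerivAt_integral] with x h1 h2 hx
    have d1 := h1 hx 0 (by simp)
    have d2 := h2 hx 0 (by simp)
    have := ((d1.fun_pow (N + 1)).const_mul ((N : ℝ) + 1)⁻¹).fun_sub d2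
    convert! this using 1
    have : (N : ℝ) + 1 ≠ 0 := by positivity
    push_cast
    field_simp
    ring)
  have h0 := hC 0 (by simp)
  have h1 := hC t (by rwa [uIcc_of_le zero_le_one])
  simp only [intervalIntegral.integral_same] at h0
  have h00 : C = 0 := by rw [← h0]; simp
  rw [h00] at h1
  rw [div_eq_inv_mul]
  linarith

/-- One Picard iteration improves the bound `C αᴺ / N!` to `C αᴺ⁺¹ / (N + 1)!`, where `α` is the
primitive of `a`. -/
theorem le_primitive_pow_succ_of_le_integral {a f : ℝ → ℝ} {C τ g : ℝ} {N : ℕ}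
    (ha : IntervalIntegrable a volume 0 1) (ha0 : ∀ s, 0 ≤ a s)
    (hτ : τ ∈ Icc (0 : ℝ) 1) (hf : ContinuousOn f (Icc 0 τ))
    (hN : ∀ t ∈ Icc 0 τ, f t ≤ C * ((∫ r in (0 : ℝ)..t, a r) ^ N / N.factorial))
    (hg : g ≤ ∫ s in (0 : ℝ)..τ, a s * f s) :
    g ≤ C * ((∫ r in (0 : ℝ)..τ, a r) ^ (N + 1) / (N + 1).factorial) := by
  have haτ : IntervalIntegrable a volume 0 τ := ha.mono_set (by
    rw [uIcc_of_le hτ.1, uIcc_of_le zero_le_one]; exact Icc_subset_Icc le_rfl hτ.2)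
  have hα : ContinuousOn (fun t => ∫ r in (0 : ℝ)..t, a r) (uIcc 0 τ) :=
    (absolutelyContinuousOnInterval_primitive haτ).continuousOn
  calc g ≤ ∫ s in (0 : ℝ)..τ, a s * f s := hg
    _ ≤ ∫ s in (0 : ℝ)..τ, (C / N.factorial) * (a s * (∫ r in (0 : ℝ)..s, a r) ^ N) := by
        refine intervalIntegral.integral_mono_on hτ.1 ?_ ?_ fun s hs => ?_
        · exact haτ.mul_continuousOn (by rwa [uIcc_of_le hτ.1])
        · exact (haτ.mul_continuousOn (hα.pow N)).const_mul _
        · calc a s * f s ≤ a s * (C * ((∫ r in (0 : ℝ)..s, a r) ^ N / N.factorial)) :=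
                mul_le_mul_of_nonneg_left (hN s hs) (ha0 s)
            _ = _ := by ring
    _ = _ := by
        rw [intervalIntegral.integral_const_mul, integral_mul_primitive_pow ha N hτ,
          Nat.factorial_succ]
        push_cast
        field_simp

/-- Grönwall's lemma with an integrable kernel, in homogeneous form. -/
theorem nonpos_of_le_integral {a f : ℝ → ℝ} {τ : ℝ} (ha : IntervalIntegrable a volume 0 1)
    (ha0 : ∀ s, 0 ≤ a s) (hτ : τ ≤ 1) (hf : ContinuousOn f (Icc 0 τ))
    (h : ∀ t ∈ Icc 0 τ, f t ≤ ∫ s in (0 : ℝ)..t, a s * f s) :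
    ∀ t ∈ Icc 0 τ, f t ≤ 0 := by
  obtain ⟨C, hC⟩ := isCompact_Icc.exists_bound_of_continuousOn hf
  have key : ∀ N : ℕ, ∀ t ∈ Icc 0 τ,
      f t ≤ C * ((∫ r in (0 : ℝ)..t, a r) ^ N / N.factorial) := by
    intro N
    induction N with
    | zero => intro t ht; simpa using (le_abs_self _).trans (hC t ht)
    | succ N ih =>
      intro t ht
      have hsub : Icc 0 t ⊆ Icc 0 τ := Icc_subset_Icc le_rfl ht.2
      exact le_primitive_pow_succ_of_le_integral ha ha0 ⟨ht.1, ht.2.trans hτ⟩ (hf.mono hsub)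
        (fun s hs => ih s (hsub hs)) (h t ht)
  intro t ht
  have hlim := (FloorSemiring.tendsto_pow_div_factorial_atTop (∫ r in (0 : ℝ)..t, a r)).const_mul C
  rw [mul_zero] at hlim
  exact ge_of_tendsto' hlim fun N => key N t ht

/-! ### Superposition operators on spaces of continuous curves -/

section Superposition

open Classical in
/-- The superposition operator `γ ↦ f ∘ γ` on continuous curves, with the value `0` where `f ∘ γ`
is not continuous. -/
noncomputable def superpose (K : Type) [TopologicalSpace K] {E F : Type}
    [NormedAddCommGroup E] [NormedAddCommGroup F] (f : E → F) (γ : C(K, E)) : C(K, F) :=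
  if h : Continuous (f ∘ γ) then ⟨f ∘ γ, h⟩ else 0

theorem superpose_apply {K : Type} [TopologicalSpace K] {E F : Type}
    [NormedAddCommGroup E] [NormedAddCommGroup F] {f : E → F} {Ω : Set E}
    (hf : ContinuousOn f Ω) {γ : C(K, E)}
    (hγ : ∀ t, γ t ∈ Ω) (t : K) : superpose K f γ t = f (γ t) := by
  have h : Continuous (f ∘ γ) := hf.comp_continuous γ.continuous hγ
  simp [superpose, h]

theorem isOpen_forall_mem {K : Type} [TopologicalSpace K] [CompactSpace K] {E : Type}
    [NormedAddCommGroup E] {Ω : Set E} (hΩ : IsOpen Ω) : IsOpen {γ : C(K, E) | ∀ t, γ t ∈ Ω} := by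
  have := ContinuousMap.isOpen_setOfPred_mapsTo (X := K) (Y := E) isCompact_univ hΩ
  simpa [MapsTo] using this

/-- A continuous bilinear map acts pointwise on continuous curves. -/
noncomputable def pointwise (K : Type) [TopologicalSpace K] [CompactSpace K] {G E F : Type}
    [NormedAddCommGroup G] [NormedSpace ℝ G] [NormedAddCommGroup E] [NormedSpace ℝ E]
    [NormedAddCommGroup F] [NormedSpace ℝ F] (b : G →L[ℝ] E →L[ℝ] F) :
    C(K, G) →L[ℝ] C(K, E) →L[ℝ] C(K, F) :=
  LinearMap.mkContinuous₂
    (LinearMap.mk₂ ℝ (fun (A : C(K, G)) (η : C(K, E)) =>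
        (⟨fun t => b (A t) (η t), by fun_prop⟩ : C(K, F)))
      (fun A B η => by ext t; simp)
      (fun c A η => by ext t; simp)
      (fun A η ξ => by ext t; simp)
      (fun c A η => by ext t; simp))
    ‖b‖ fun A η => by
      refine (ContinuousMap.norm_le _ (by positivity)).2 fun t => ?_
      refine (b.le_opNorm₂ (A t) (η t)).trans ?_
      gcongr
      exacts [A.norm_coe_le_norm t, η.norm_coe_le_norm t]

@[simp] theorem pointwise_apply {K : Type} [TopologicalSpace K] [CompactSpace K] {G E F : Type}
    [NormedAddCommGroup G] [NormedSpace ℝ G] [NormedAddCommGroup E] [NormedSpace ℝ E]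
    [NormedAddCommGroup F] [NormedSpace ℝ F] (b : G →L[ℝ] E →L[ℝ] F)
    (A : C(K, G)) (η : C(K, E)) (t : K) : pointwise K b A η t = b (A t) (η t) := rfl

variable {K : Type} [TopologicalSpace K] [CompactSpace K]
  {E F : Type} [NormedAddCommGroup E] [NormedSpace ℝ E] [NormedAddCommGroup F] [NormedSpace ℝ F]

/-- The derivative of the superposition operator of a smooth map is pointwise application of the
derivative: by compactness the first order expansions along `γ` are uniform. -/
theorem hasFDerivAt_superpose {f : E → F} {Ω : Set E} (hΩ : IsOpen Ω) (hf : ContDiffOn ℝ ∞ f Ω)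
    {γ : C(K, E)} (hγ : ∀ t, γ t ∈ Ω) :
    HasFDerivAt (superpose K f)
      (pointwise K (ContinuousLinearMap.id ℝ (E →L[ℝ] F)) (superpose K (fderiv ℝ f) γ)) γ := by
  have hfc := hf.continuousOn
  have hf'c : ContinuousOn (fderiv ℝ f) Ω := hf.continuousOn_fderiv_of_isOpen hΩ (by simp)
  rw [hasFDerivAt_iff_isLittleO_nhds_zero, Asymptotics.isLittleO_iff]
  intro ε hε
  -- strict differentiability at `γ t₀` and continuity of the derivative give the expansion with
  -- error `ε` at all points `γ t` with `t` near `t₀`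
  have key : ∀ t₀ : K, ∀ᶠ z : E × K in 𝓝 (0, t₀),
      ‖f (γ z.2 + z.1) - f (γ z.2) - fderiv ℝ f (γ z.2) z.1‖ ≤ ε * ‖z.1‖ := by
    intro t₀
    have hat : ContDiffAt ℝ ∞ f (γ t₀) := hf.contDiffAt (hΩ.mem_nhds (hγ t₀))
    have h1 := (hat.hasStrictFDerivAt (by simp)).isLittleO
    rw [Asymptotics.isLittleO_iff] at h1
    have c1 : Tendsto (fun z : E × K => (γ z.2 + z.1, γ z.2)) (𝓝 (0, t₀))
        (𝓝 (γ t₀, γ t₀)) := by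
      have : Continuous (fun z : E × K => (γ z.2 + z.1, γ z.2)) := by fun_prop
      simpa using this.tendsto (0, t₀)
    have c2 : Tendsto (fun z : E × K => fderiv ℝ f (γ z.2)) (𝓝 (0, t₀))
        (𝓝 (fderiv ℝ f (γ t₀))) := by
      have h0 : ContinuousAt (fderiv ℝ f) (γ t₀) := hf'c.continuousAt (hΩ.mem_nhds (hγ t₀))
      have : Continuous (fun z : E × K => γ z.2) := by fun_prop
      exact h0.tendsto.comp (this.tendsto (0, t₀))
    filter_upwards [c1.eventually (h1 (half_pos hε)),
      c2.eventually (Metric.closedBall_mem_nhds _ (half_pos hε))] with z hz1 hz2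
    have hz2' : ‖fderiv ℝ f (γ z.2) - fderiv ℝ f (γ t₀)‖ ≤ ε / 2 := by
      simpa [dist_eq_norm] using hz2
    have e : f (γ z.2 + z.1) - f (γ z.2) - fderiv ℝ f (γ z.2) z.1 =
        (f (γ z.2 + z.1) - f (γ z.2) - fderiv ℝ f (γ t₀) (γ z.2 + z.1 - γ z.2)) -
          (fderiv ℝ f (γ z.2) - fderiv ℝ f (γ t₀)) z.1 := by
      simp
    rw [e]
    refine (norm_sub_le _ _).trans ?_
    have h3 := (fderiv ℝ f (γ z.2) - fderiv ℝ f (γ t₀)).le_of_opNorm_le hz2' z.1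
    simp only [add_sub_cancel_left] at hz1 ⊢
    linarith
  have huni := isCompact_univ.eventually_forall_of_forall_eventually
    (x₀ := (0 : E)) (K := (univ : Set K))
    (P := fun h t => ‖f (γ t + h) - f (γ t) - fderiv ℝ f (γ t) h‖ ≤ ε * ‖h‖)
    (fun t _ => key t)
  obtain ⟨δ, hδ, hball⟩ := Metric.eventually_nhds_iff_ball.1 huni
  have hdom : ∀ᶠ h : C(K, E) in 𝓝 0, ∀ t, (γ + h) t ∈ Ω := by
    have : Tendsto (fun h : C(K, E) => γ + h) (𝓝 0) (𝓝 γ) := by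
      have hc : Continuous fun h : C(K, E) => γ + h := by fun_prop
      simpa using hc.tendsto 0
    exact this.eventually ((isOpen_forall_mem hΩ).mem_nhds hγ)
  filter_upwards [Metric.ball_mem_nhds (0 : C(K, E)) hδ, hdom] with h hh hd
  refine (ContinuousMap.norm_le _ (by positivity)).2 fun t => ?_
  have hht : h t ∈ Metric.ball (0 : E) δ := by
    rw [mem_ball_zero_iff] at hh ⊢
    exact (h.norm_coe_le_norm t).trans_lt hh
  have := hball _ hht t (mem_univ t)
  rw [ContinuousMap.sub_apply, ContinuousMap.sub_apply, pointwise_apply,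
    ContinuousLinearMap.id_apply,
    superpose_apply hfc hd, superpose_apply hfc hγ, superpose_apply hf'c hγ]
  exact this.trans (mul_le_mul_of_nonneg_left (h.norm_coe_le_norm t) hε.le)

theorem contDiffOn_superpose {f : E → F} {Ω : Set E} (hΩ : IsOpen Ω) (hf : ContDiffOn ℝ ∞ f Ω) :
    ContDiffOn ℝ ∞ (superpose K f) {γ : C(K, E) | ∀ t, γ t ∈ Ω} := by
  rw [contDiffOn_infty]
  intro m
  induction m generalizing F with
  | zero =>
    exact contDiffOn_zero.2 fun γ hγ =>
      (hasFDerivAt_superpose hΩ hf hγ).continuousAt.continuousWithinAt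
  | succ m ih =>
    have ho := isOpen_forall_mem (K := K) hΩ
    push_cast
    refine (contDiffOn_succ_iff_fderiv_of_isOpen ho).2 ⟨fun γ hγ =>
      (hasFDerivAt_superpose hΩ hf hγ).differentiableAt.differentiableWithinAt, by simp, ?_⟩
    have h2 : ContDiffOn ℝ m (superpose K (fderiv ℝ f)) {γ : C(K, E) | ∀ t, γ t ∈ Ω} :=
      ih (hf.fderiv_of_isOpen hΩ le_rfl)
    have hL : ContDiff ℝ m (pointwise K (ContinuousLinearMap.id ℝ (E →L[ℝ] F))) :=
      (pointwise K (ContinuousLinearMap.id ℝ (E →L[ℝ] F))).contDiff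
    have h3 : ContDiffOn ℝ m (fun γ =>
        pointwise K (ContinuousLinearMap.id ℝ (E →L[ℝ] F)) (superpose K (fderiv ℝ f) γ))
        {γ : C(K, E) | ∀ t, γ t ∈ Ω} :=
      hL.comp_contDiffOn h2
    exact h3.congr fun γ hγ => (hasFDerivAt_superpose hΩ hf hγ).fderiv

end Superposition

/-! ### Volterra operators with integrable kernel -/

section Volterra

variable {W G E : Type} [NormedAddCommGroup W] [NormedSpace ℝ W] [NormedAddCommGroup G]
  [NormedSpace ℝ G] [NormedAddCommGroup E] [NormedSpace ℝ E]

/-- The extension of a curve on `[0,1]` to the real line that is constant on either side. -/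
noncomputable def extendCurve {W : Type} [TopologicalSpace W] (A : C(Icc (0 : ℝ) 1, W)) (s : ℝ) : W :=
  A (projIcc 0 1 zero_le_one s)

theorem extendCurve_of_mem {W : Type} [TopologicalSpace W] (A : C(Icc (0 : ℝ) 1, W)) {s : ℝ}
    (hs : s ∈ Icc (0 : ℝ) 1) : extendCurve A s = A ⟨s, hs⟩ := by
  rw [extendCurve, projIcc_of_mem _ hs]

theorem continuous_extendCurve {W : Type} [TopologicalSpace W] (A : C(Icc (0 : ℝ) 1, W)) :
    Continuous (extendCurve A) := A.continuous.comp continuous_projIcc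

theorem norm_extendCurve_le {W : Type} [NormedAddCommGroup W] (A : C(Icc (0 : ℝ) 1, W)) (s : ℝ) :
    ‖extendCurve A s‖ ≤ ‖A‖ := A.norm_coe_le_norm _

theorem integrable_apply_extendCurve (b : W →L[ℝ] G →L[ℝ] E) (A : C(Icc (0 : ℝ) 1, W))
    {u : ℝ → G} (hu : IntegrableOn u (Icc 0 1)) :
    IntegrableOn (fun s => b (extendCurve A s) (u s)) (Icc 0 1) := by
  refine (hu.norm.const_mul (‖b‖ * ‖A‖)).mono'
    (b.aestronglyMeasurable_comp₂ (continuous_extendCurve A).aestronglyMeasurable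
      hu.aestronglyMeasurable) (Eventually.of_forall fun s => ?_)
  refine (b.le_opNorm₂ _ _).trans ?_
  gcongr
  exact norm_extendCurve_le A s

theorem intervalIntegrable_of_mem_Icc {E : Type} [NormedAddCommGroup E] {f : ℝ → E} {a b : ℝ}
    (hf : IntegrableOn f (Icc a b)) {s t : ℝ} (hs : s ∈ Icc a b) (ht : t ∈ Icc a b) :
    IntervalIntegrable f volume s t :=
  (hf.mono_set (uIcc_subset_Icc hs ht)).intervalIntegrable

theorem tendsto_integral_tail {f : ℝ → ℝ} (hf : IntegrableOn f (Icc 0 1)) :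
    Tendsto (fun τ => ∫ s in τ..1, f s) (𝓝[<] 1) (𝓝 0) := by
  have h1 := intervalIntegral.continuousOn_primitive_interval_left (a := 0) (b := 1)
    (by simpa using hf) 1 (by simp)
  have h2 : Tendsto (fun τ => ∫ s in τ..1, f s) (𝓝[uIcc 0 1] 1) (𝓝 0) := by
    simpa [ContinuousWithinAt] using h1
  refine h2.mono_left ?_
  rw [← nhdsWithin_Ico_eq_nhdsLT (zero_lt_one' ℝ), uIcc_of_le zero_le_one]
  exact nhdsWithin_mono _ Ico_subset_Icc_self

theorem control_integrableOn {G : Type} [NormedAddCommGroup G]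
    (u : Lp G 1 (volume.restrict (Icc (0 : ℝ) 1))) :
    IntegrableOn u (Icc 0 1) := L1.integrable_coeFn u

theorem norm_control_eq {G : Type} [NormedAddCommGroup G]
    (u : Lp G 1 (volume.restrict (Icc (0 : ℝ) 1))) :
    ‖u‖ = ∫ s in (0 : ℝ)..1, ‖u s‖ := by
  rw [L1.norm_eq_integral_norm, intervalIntegral.integral_of_le zero_le_one,
    integral_Icc_eq_integral_Ioc]

theorem ae_of_ae_restrict_Icc {p : ℝ → Prop} (h : ∀ᵐ s ∂(volume.restrict (Icc (0 : ℝ) 1)), p s)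
    {s t : ℝ} (hs : s ∈ Icc (0 : ℝ) 1) (ht : t ∈ Icc (0 : ℝ) 1) :
    ∀ᵐ r, r ∈ uIoc s t → p r := by
  rw [ae_restrict_iff' measurableSet_Icc] at h
  filter_upwards [h] with r hr hrst
  exact hr (uIcc_subset_Icc hs ht (uIoc_subset_uIcc hrst))

/-- The primitive, vanishing at `0`, of an integrable function on `[0,1]`. -/
noncomputable def primitiveCurve (f : ℝ → E) (hf : IntegrableOn f (Icc 0 1)) :
    C(Icc (0 : ℝ) 1, E) where
  toFun t := ∫ s in (0 : ℝ)..t, f s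
  continuous_toFun := by
    have := intervalIntegral.continuousOn_primitive_interval (a := 0) (b := 1) (by simpa using hf)
    rw [uIcc_of_le zero_le_one] at this
    exact continuousOn_iff_continuous_domRestrict.1 this

theorem primitiveCurve_apply {f : ℝ → E} (hf : IntegrableOn f (Icc 0 1)) (t : Icc (0 : ℝ) 1) :
    primitiveCurve f hf t = ∫ s in (0 : ℝ)..t, f s := rfl

/-- The bilinear Volterra operator sending a curve `A` and an integrable function `u` to the
primitive of `s ↦ b (A s) (u s)` vanishing at `0`. -/
noncomputable def volterra (b : W →L[ℝ] G →L[ℝ] E) :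
    C(Icc (0 : ℝ) 1, W) →L[ℝ] Lp G 1 (volume.restrict (Icc (0 : ℝ) 1)) →L[ℝ]
      C(Icc (0 : ℝ) 1, E) :=
  LinearMap.mkContinuous₂
    (LinearMap.mk₂ ℝ (fun A u => primitiveCurve _
        (integrable_apply_extendCurve b A (control_integrableOn u)))
      (fun A B u => by
        ext t
        have hA := fun A => intervalIntegrable_of_mem_Icc
          (integrable_apply_extendCurve b A (control_integrableOn u)) (left_mem_Icc.2 zero_le_one) t.2
        simp only [primitiveCurve_apply, ContinuousMap.add_apply]
        rw [← intervalIntegral.integral_add (hA A) (hA B)]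
        simp [extendCurve])
      (fun c A u => by
        ext t
        simp only [primitiveCurve_apply, ContinuousMap.smul_apply]
        rw [← intervalIntegral.integral_smul]
        simp [extendCurve])
      (fun A u v => by
        ext t
        have hA := fun u => intervalIntegrable_of_mem_Icc
          (integrable_apply_extendCurve b A (control_integrableOn u)) (left_mem_Icc.2 zero_le_one) t.2
        simp only [primitiveCurve_apply, ContinuousMap.add_apply]
        rw [← intervalIntegral.integral_add (hA u) (hA v)]
        refine intervalIntegral.integral_congr_ae ?_
        filter_upwards [ae_of_ae_restrict_Icc (Lp.coeFn_add u v) (left_mem_Icc.2 zero_le_one) t.2]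
          with s hs hst
        simp only [hs hst, Pi.add_apply, map_add])
      (fun c A u => by
        ext t
        simp only [primitiveCurve_apply, ContinuousMap.smul_apply]
        rw [← intervalIntegral.integral_smul]
        refine intervalIntegral.integral_congr_ae ?_
        filter_upwards [ae_of_ae_restrict_Icc (Lp.coeFn_smul c u) (left_mem_Icc.2 zero_le_one) t.2]
          with s hs hst
        simp only [hs hst, Pi.smul_apply, map_smul]))
    ‖b‖ fun A u => by
      refine (ContinuousMap.norm_le _ (by positivity)).2 fun t => ?_
      have hu := (control_integrableOn u).norm
      calc ‖∫ s in (0 : ℝ)..t, b (extendCurve A s) (u s)‖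
          ≤ ∫ s in (0 : ℝ)..t, ‖b‖ * ‖A‖ * ‖u s‖ := by
            refine intervalIntegral.norm_integral_le_of_norm_le t.2.1
              (Eventually.of_forall fun s _ => ?_)
              ((intervalIntegrable_of_mem_Icc hu (left_mem_Icc.2 zero_le_one) t.2).const_mul _)
            refine (b.le_opNorm₂ _ _).trans ?_
            gcongr
            exact norm_extendCurve_le A s
        _ ≤ ∫ s in (0 : ℝ)..1, ‖b‖ * ‖A‖ * ‖u s‖ :=
            intervalIntegral.integral_mono_interval le_rfl t.2.1 t.2.2
              (Eventually.of_forall fun s => by positivity)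
              ((intervalIntegrable_of_mem_Icc hu (left_mem_Icc.2 zero_le_one)
                (right_mem_Icc.2 zero_le_one)).const_mul _)
        _ = ‖b‖ * ‖A‖ * ‖u‖ := by
            rw [intervalIntegral.integral_const_mul, norm_control_eq]

theorem volterra_apply (b : W →L[ℝ] G →L[ℝ] E) (A : C(Icc (0 : ℝ) 1, W))
    (u : Lp G 1 (volume.restrict (Icc (0 : ℝ) 1))) (t : Icc (0 : ℝ) 1) :
    volterra b A u t = ∫ s in (0 : ℝ)..t, b (extendCurve A s) (u s) := rfl

theorem isInvertible_one_sub_of_norm_pow_lt_one {Y : Type*} [NormedAddCommGroup Y]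
    [NormedSpace ℝ Y] [CompleteSpace Y] (T : Y →L[ℝ] Y) (N : ℕ) (hN : ‖T ^ N‖ < 1) :
    (ContinuousLinearMap.id ℝ Y - T).IsInvertible := by
  have hu : IsUnit (1 - T ^ N) := isUnit_one_sub_of_norm_lt_one hN
  have hcomm : Commute (1 - T) (∑ i ∈ Finset.range N, T ^ i) := by
    refine Commute.sum_right _ _ _ fun i _ => ?_
    exact (Commute.one_left _).sub_left ((Commute.refl T).pow_right i)
  rw [← mul_neg_geom_sum, hcomm.isUnit_mul_iff] at hu
  obtain ⟨v, hv⟩ := hu.1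
  refine ContinuousLinearMap.IsInvertible.of_inverse (g := ((v⁻¹ : (Y →L[ℝ] Y)ˣ) : Y →L[ℝ] Y))
    ?_ ?_
  · change (1 - T) * _ = 1
    rw [← hv, Units.mul_inv]
  · change _ * (1 - T) = 1
    rw [← hv, Units.inv_mul]

/-- A Volterra operator with integrable kernel is quasinilpotent, so `1 - T` is invertible. -/
theorem isInvertible_one_sub_of_norm_le_integral [CompleteSpace E]
    (T : C(Icc (0 : ℝ) 1, E) →L[ℝ] C(Icc (0 : ℝ) 1, E)) {a : ℝ → ℝ}
    (ha : IntervalIntegrable a volume 0 1) (ha0 : ∀ s, 0 ≤ a s)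
    (hT : ∀ η t, ‖T η t‖ ≤ ∫ s in (0 : ℝ)..t, a s * ‖extendCurve η s‖) :
    (ContinuousLinearMap.id ℝ _ - T).IsInvertible := by
  have key : ∀ (N : ℕ) (η : C(Icc (0 : ℝ) 1, E)) (t : Icc (0 : ℝ) 1), ‖(T ^ N) η t‖ ≤
      ‖η‖ * ((∫ r in (0 : ℝ)..t, a r) ^ N / N.factorial) := by
    intro N
    induction N with
    | zero => intro η t; simpa using η.norm_coe_le_norm t
    | succ N ih =>
      intro η t
      have e : (T ^ (N + 1)) η = T ((T ^ N) η) := by rw [pow_succ']; rfl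
      rw [e]
      refine le_primitive_pow_succ_of_le_integral ha ha0 t.2
        (continuous_extendCurve ((T ^ N) η)).norm.continuousOn (fun s hs => ?_) (hT _ t)
      have hs' : s ∈ Icc (0 : ℝ) 1 := ⟨hs.1, hs.2.trans t.2.2⟩
      rw [extendCurve_of_mem _ hs']
      exact ih η ⟨s, hs'⟩
  have hlim := FloorSemiring.tendsto_pow_div_factorial_atTop (∫ r in (0 : ℝ)..1, a r)
  obtain ⟨N, hN⟩ := (hlim.eventually (gt_mem_nhds (half_pos one_pos))).exists
  have hint : 0 ≤ ∫ r in (0 : ℝ)..1, a r :=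
    intervalIntegral.integral_nonneg zero_le_one fun s _ => ha0 s
  have hnorm : ‖T ^ N‖ < 1 := by
    refine lt_of_le_of_lt (ContinuousLinearMap.opNorm_le_bound _ (by positivity) fun η => ?_)
      (hN.trans (by norm_num))
    refine (ContinuousMap.norm_le _ (by positivity)).2 fun t => (key N η t).trans ?_
    rw [mul_comm]
    have h0 : 0 ≤ ∫ r in (0 : ℝ)..t, a r :=
      intervalIntegral.integral_nonneg t.2.1 fun s _ => ha0 s
    have h1 : ∫ r in (0 : ℝ)..t, a r ≤ ∫ r in (0 : ℝ)..1, a r :=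
      intervalIntegral.integral_mono_interval le_rfl t.2.1 t.2.2 (Eventually.of_forall ha0) ha
    gcongr
  exact isInvertible_one_sub_of_norm_pow_lt_one T N hnorm

end Volterra

/-! ### The control equation in integral form and uniqueness of trajectories -/

section Trajectories

variable {n k : ℕ}

/-- The linear map `w ↦ ∑ᵢ wᵢ Xᵢ(p)` from control values to velocities at `p`. -/
noncomputable def velocity (X : Fin k → Rn n → Rn n) (p : Rn n) : Rn k →L[ℝ] Rn n :=
  ∑ i, (EuclideanSpace.proj i : Rn k →L[ℝ] ℝ).smulRight (X i p)

theorem velocity_apply (X : Fin k → Rn n → Rn n) (p : Rn n) (w : Rn k) :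
    velocity X p w = ∑ i, w i • X i p := by
  simp [velocity]

theorem contDiffOn_velocity {M : Set (Rn n)} {X : Fin k → Rn n → Rn n}
    (hX : ∀ i, ContDiffOn ℝ ∞ (X i) M) : ContDiffOn ℝ ∞ (velocity X) M :=
  ContDiffOn.sum fun i _ => contDiffOn_const.smulRight (hX i)

theorem norm_velocity_sub_le {M : Set (Rn n)} {X : Fin k → Rn n → Rn n} {L : ℝ}
    (hL : ∀ i, ∀ x ∈ M, ∀ y ∈ M, ‖X i x - X i y‖ ≤ L * ‖x - y‖) {p q : Rn n} (hp : p ∈ M)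
    (hq : q ∈ M) (w : Rn k) :
    ‖velocity X p w - velocity X q w‖ ≤ k * |L| * ‖w‖ * ‖p - q‖ := by
  rw [velocity_apply, velocity_apply, ← Finset.sum_sub_distrib]
  calc ‖∑ i, (w i • X i p - w i • X i q)‖ ≤ ∑ _i : Fin k, ‖w‖ * (|L| * ‖p - q‖) := by
        refine norm_sum_le_of_le _ fun i _ => ?_
        rw [← smul_sub, norm_smul]
        refine mul_le_mul (PiLp.norm_apply_le w i) ((hL i p hp q hq).trans ?_) (norm_nonneg _)
          (norm_nonneg _)
        gcongr
        exact le_abs_self L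
    _ = k * |L| * ‖w‖ * ‖p - q‖ := by simp; ring

/-- `γ` is a trajectory in `M` with control `u` on `[a,b]`: the control equation in integral
form. -/
structure IsTrajectory (M : Set (Rn n)) (X : Fin k → Rn n → Rn n) (u : ℝ → Rn k)
    (γ : ℝ → Rn n) (a b : ℝ) : Prop where
  integrableOn : IntegrableOn u (Icc a b)
  continuousOn : ContinuousOn γ (Icc a b)
  mem : ∀ t ∈ Icc a b, γ t ∈ M
  integral_eq : ∀ s ∈ Icc a b, ∀ t ∈ Icc a b,
    ∫ r in s..t, velocity X (γ r) (u r) = γ t - γ s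

theorem integrableOn_velocity {M : Set (Rn n)} {X : Fin k → Rn n → Rn n}
    (hX : ∀ i, ContDiffOn ℝ ∞ (X i) M) {u : ℝ → Rn k} {γ : ℝ → Rn n} {a b : ℝ}
    (hu : IntegrableOn u (Icc a b)) (hγ : ContinuousOn γ (Icc a b)) (hM : ∀ t ∈ Icc a b, γ t ∈ M) :
    IntegrableOn (fun r => velocity X (γ r) (u r)) (Icc a b) := by
  have hc : ContinuousOn (fun r => velocity X (γ r)) (Icc a b) :=
    (contDiffOn_velocity hX).continuousOn.comp hγ hM
  obtain ⟨C, hC⟩ := isCompact_Icc.exists_bound_of_continuousOn hc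
  refine (hu.norm.const_mul C).mono' ((ContinuousLinearMap.id ℝ _).aestronglyMeasurable_comp₂
    (hc.aestronglyMeasurable measurableSet_Icc) hu.aestronglyMeasurable) ?_
  filter_upwards [ae_restrict_mem measurableSet_Icc] with r hr
  exact (velocity X (γ r)).le_of_opNorm_le (hC r hr) (u r)

theorem isTrajectory_of_forall_eq_add {M : Set (Rn n)} {X : Fin k → Rn n → Rn n}
    (hX : ∀ i, ContDiffOn ℝ ∞ (X i) M) {u : ℝ → Rn k} {γ : ℝ → Rn n} {a b : ℝ} {x : Rn n}
    (hu : IntegrableOn u (Icc a b)) (hγ : ContinuousOn γ (Icc a b)) (hM : ∀ t ∈ Icc a b, γ t ∈ M)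
    (h : ∀ t ∈ Icc a b, γ t = x + ∫ r in a..t, velocity X (γ r) (u r)) :
    IsTrajectory M X u γ a b := by
  refine ⟨hu, hγ, hM, fun s hs t ht => ?_⟩
  have hint := integrableOn_velocity hX hu hγ hM
  have ha : a ∈ Icc a b := ⟨le_rfl, hs.1.trans hs.2⟩
  rw [h t ht, h s hs, add_sub_add_left_eq_sub, intervalIntegral.integral_interval_sub_left
    (intervalIntegrable_of_mem_Icc hint ha ht) (intervalIntegrable_of_mem_Icc hint ha hs)]

/-- Carathéodory's integral form of the control equation. -/
theorem isControlledCurve_iff {M : Set (Rn n)} {X : Fin k → Rn n → Rn n}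
    (hX : ∀ i, ContDiffOn ℝ ∞ (X i) M) {u : Control k} {x : Rn n} {γ : ℝ → Rn n} :
    IsControlledCurve M X u x γ ↔ γ 0 = x ∧ IsTrajectory M X u γ 0 1 := by
  have h0 : (0 : ℝ) ∈ Icc (0 : ℝ) 1 := left_mem_Icc.2 zero_le_one
  have h1 : (1 : ℝ) ∈ Icc (0 : ℝ) 1 := right_mem_Icc.2 zero_le_one
  have hu := control_integrableOn u
  constructor
  · intro h
    have hγ : ContinuousOn γ (Icc 0 1) := by
      simpa [uIcc_of_le zero_le_one] using h.absCont.continuousOn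
    have hint := intervalIntegrable_of_mem_Icc (integrableOn_velocity hX hu hγ h.mem) h0 h1
    refine ⟨h.init, isTrajectory_of_forall_eq_add hX (x := x) hu hγ h.mem fun t ht => ?_⟩
    have hd := h.deriv
    rw [ae_restrict_iff' measurableSet_Icc] at hd
    obtain ⟨C, hC⟩ := (h.absCont.fun_sub
      (absolutelyContinuousOnInterval_primitive hint)).const_of_ae_hasDerivAt_zero (by
        filter_upwards [hd, hint.ae_hasDerivAt_integral] with s hs1 hs2 hs
        have d1 := hs1 (by simpa [uIcc_of_le zero_le_one] using hs)
        have d2 := hs2 hs 0 (by simp)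
        have d3 := d1.fun_sub d2
        rwa [velocity_apply, sub_self] at d3)
    rw [uIcc_of_le zero_le_one] at hC
    have e0 := hC 0 h0
    rw [intervalIntegral.integral_same, sub_zero, h.init] at e0
    rw [e0]
    exact sub_eq_iff_eq_add.1 (hC t ht)
  · rintro ⟨hx, h⟩
    have hint := intervalIntegrable_of_mem_Icc
      (integrableOn_velocity hX hu h.continuousOn h.mem) h0 h1
    refine ⟨h.mem, hx, ?_, ?_⟩
    · refine absolutelyContinuousOnInterval_of_dist_le
        (absolutelyContinuousOnInterval_primitive hint) fun s hs t ht => ?_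
      rw [uIcc_of_le zero_le_one] at hs ht
      rw [h.integral_eq 0 h0 s hs, h.integral_eq 0 h0 t ht, dist_sub_right]
    · rw [ae_restrict_iff' measurableSet_Icc]
      have n0 : ∀ᵐ t : ℝ, t ≠ 0 := by simp [ae_iff, measure_singleton]
      have n1 : ∀ᵐ t : ℝ, t ≠ 1 := by simp [ae_iff, measure_singleton]
      filter_upwards [hint.ae_hasDerivAt_integral, n0, n1] with t ht ht0 ht1 hmem
      have d := (ht (by rwa [uIcc_of_le zero_le_one]) 0 (by simp)).const_add (γ 0)
      rw [velocity_apply] at d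
      refine d.congr_of_eventuallyEq ?_
      filter_upwards [Ioo_mem_nhds (lt_of_le_of_ne hmem.1 ht0.symm) (lt_of_le_of_ne hmem.2 ht1)]
        with s hs
      rw [h.integral_eq 0 h0 s (Ioo_subset_Icc_self hs)]
      abel

theorem IsTrajectory.eqOn {M : Set (Rn n)} {X : Fin k → Rn n → Rn n}
    (hX : ∀ i, ContDiffOn ℝ ∞ (X i) M)
    (hlip : ∃ L : ℝ, ∀ i, ∀ x ∈ M, ∀ y ∈ M, ‖X i x - X i y‖ ≤ L * ‖x - y‖) {u : ℝ → Rn k}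
    {γ γ' : ℝ → Rn n} (h : IsTrajectory M X u γ 0 1) (h' : IsTrajectory M X u γ' 0 1)
    (h0 : γ 0 = γ' 0) : EqOn γ γ' (Icc 0 1) := by
  obtain ⟨L, hL⟩ := hlip
  have h00 : (0 : ℝ) ∈ Icc (0 : ℝ) 1 := left_mem_Icc.2 zero_le_one
  have h1 : (1 : ℝ) ∈ Icc (0 : ℝ) 1 := right_mem_Icc.2 zero_le_one
  have ha : IntervalIntegrable (fun s => k * |L| * ‖u s‖) volume 0 1 :=
    (intervalIntegrable_of_mem_Icc h.integrableOn.norm h00 h1).const_mul _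
  have hf : ContinuousOn (fun s => ‖γ s - γ' s‖) (Icc 0 1) :=
    (h.continuousOn.sub h'.continuousOn).norm
  have key := nonpos_of_le_integral ha (fun s => by positivity) le_rfl hf fun t ht => by
    have i1 := intervalIntegrable_of_mem_Icc
      (integrableOn_velocity hX h.integrableOn h.continuousOn h.mem) h00 ht
    have i2 := intervalIntegrable_of_mem_Icc
      (integrableOn_velocity hX h'.integrableOn h'.continuousOn h'.mem) h00 ht
    have hsub : uIcc 0 t ⊆ Icc 0 1 := uIcc_subset_Icc h00 ht
    have e : γ t - γ' t = ∫ s in (0 : ℝ)..t, (velocity X (γ s) (u s) - velocity X (γ' s) (u s)) := by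
      rw [intervalIntegral.integral_sub i1 i2, h.integral_eq 0 h00 t ht,
        h'.integral_eq 0 h00 t ht, h0]
      abel
    rw [e]
    refine intervalIntegral.norm_integral_le_of_norm_le ht.1 (Eventually.of_forall fun s hs => ?_)
      ((ha.mono_set (by simpa [uIcc_of_le zero_le_one] using hsub)).mul_continuousOn (hf.mono hsub))
    have hs' : s ∈ Icc (0 : ℝ) 1 := ⟨hs.1.le, hs.2.trans ht.2⟩
    exact norm_velocity_sub_le hL (h.mem s hs') (h'.mem s hs') (u s)
  intro t ht
  exact sub_eq_zero.1 (norm_le_zero_iff.1 (key t ht))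

/-- The control equation as a fixed point equation in the Banach space of continuous curves. -/
structure IsSolution (M : Set (Rn n)) (X : Fin k → Rn n → Rn n) (u : Control k) (x : Rn n)
    (η : C(Icc (0 : ℝ) 1, Rn n)) : Prop where
  mem : ∀ t, η t ∈ M
  eq : η = ContinuousMap.const _ x +
    volterra (ContinuousLinearMap.id ℝ _) (superpose _ (velocity X) η) u

theorem isSolution_iff {M : Set (Rn n)} {X : Fin k → Rn n → Rn n}
    (hX : ∀ i, ContDiffOn ℝ ∞ (X i) M) {u : Control k} {x : Rn n} {η : C(Icc (0 : ℝ) 1, Rn n)} :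
    IsSolution M X u x η ↔ IsControlledCurve M X u x (extendCurve η) := by
  have h00 : (0 : ℝ) ∈ Icc (0 : ℝ) 1 := left_mem_Icc.2 zero_le_one
  have e : ∀ (_ : ∀ t, η t ∈ M) (t : Icc (0 : ℝ) 1),
      (ContinuousMap.const _ x + volterra (ContinuousLinearMap.id ℝ _)
        (superpose _ (velocity X) η) u : C(Icc (0 : ℝ) 1, Rn n)) t =
      x + ∫ s in (0 : ℝ)..t, velocity X (extendCurve η s) (u s) := by
    intro hM t
    rw [ContinuousMap.add_apply, volterra_apply, ContinuousMap.const_apply]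
    simp only [extendCurve, superpose_apply (contDiffOn_velocity hX).continuousOn hM,
      ContinuousLinearMap.id_apply]
  rw [isControlledCurve_iff hX]
  constructor
  · intro h
    have h' : ∀ t ∈ Icc (0 : ℝ) 1, extendCurve η t =
        x + ∫ s in (0 : ℝ)..t, velocity X (extendCurve η s) (u s) := fun t ht => by
      rw [extendCurve_of_mem _ ht, ← e h.mem ⟨t, ht⟩, ← h.eq]
    refine ⟨by simpa using h' 0 h00, isTrajectory_of_forall_eq_add hX (control_integrableOn u)
      (continuous_extendCurve η).continuousOn (fun t _ => h.mem _) h'⟩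
  · rintro ⟨hx, h⟩
    have hM : ∀ t, η t ∈ M := fun t => by
      have := h.mem t t.2
      rwa [extendCurve_of_mem _ t.2] at this
    refine ⟨hM, ?_⟩
    ext1 t
    rw [e hM t, h.integral_eq 0 h00 t t.2, hx, extendCurve_of_mem _ t.2]
    abel

theorem exists_isSolution_of_isControlledCurve {M : Set (Rn n)} {X : Fin k → Rn n → Rn n}
    (hX : ∀ i, ContDiffOn ℝ ∞ (X i) M) {u : Control k} {x : Rn n} {γ : ℝ → Rn n}
    (h : IsControlledCurve M X u x γ) :
    ∃ η, IsSolution M X u x η ∧ ∀ t : Icc (0 : ℝ) 1, η t = γ t := by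
  obtain ⟨hx, ht⟩ := (isControlledCurve_iff hX).1 h
  let η : C(Icc (0 : ℝ) 1, Rn n) :=
    ⟨fun t => γ t, continuousOn_iff_continuous_domRestrict.1 ht.continuousOn⟩
  have he : ∀ t ∈ Icc (0 : ℝ) 1, extendCurve η t = γ t := fun t ht => extendCurve_of_mem η ht
  refine ⟨η, (isSolution_iff hX).2 ((isControlledCurve_iff hX).2 ⟨?_, ?_⟩), fun t => rfl⟩
  · rw [he 0 (left_mem_Icc.2 zero_le_one), hx]
  · refine ⟨ht.integrableOn, (continuous_extendCurve η).continuousOn, fun t h => ?_,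
      fun s hs t h => ?_⟩
    · rw [he t h]; exact ht.mem t h
    · rw [he t h, he s hs, ← ht.integral_eq s hs t h]
      refine intervalIntegral.integral_congr fun r hr => ?_
      simp only [he r (uIcc_subset_Icc hs h hr)]

theorem isControlledCurve_eqOn {M : Set (Rn n)} {X : Fin k → Rn n → Rn n}
    (hX : ∀ i, ContDiffOn ℝ ∞ (X i) M)
    (hlip : ∃ L : ℝ, ∀ i, ∀ x ∈ M, ∀ y ∈ M, ‖X i x - X i y‖ ≤ L * ‖x - y‖) {u : Control k}
    {x : Rn n} {γ γ' : ℝ → Rn n} (h : IsControlledCurve M X u x γ)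
    (h' : IsControlledCurve M X u x γ') : EqOn γ γ' (Icc 0 1) :=
  ((isControlledCurve_iff hX).1 h).2.eqOn hX hlip ((isControlledCurve_iff hX).1 h').2
    (h.init.trans h'.init.symm)

theorem endMap_eq {M : Set (Rn n)} {X : Fin k → Rn n → Rn n}
    (hX : ∀ i, ContDiffOn ℝ ∞ (X i) M)
    (hlip : ∃ L : ℝ, ∀ i, ∀ x ∈ M, ∀ y ∈ M, ‖X i x - X i y‖ ≤ L * ‖x - y‖) {u : Control k}
    {x : Rn n} {γ : ℝ → Rn n} (h : IsControlledCurve M X u x γ) : endMap M X x u = γ 1 := by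
  have hex : ∃ γ, IsControlledCurve M X u x γ := ⟨γ, h⟩
  rw [endMap, dif_pos hex]
  exact isControlledCurve_eqOn hX hlip hex.choose_spec h (right_mem_Icc.2 zero_le_one)

theorem IsSolution.endMap_eq {M : Set (Rn n)} {X : Fin k → Rn n → Rn n}
    (hX : ∀ i, ContDiffOn ℝ ∞ (X i) M)
    (hlip : ∃ L : ℝ, ∀ i, ∀ x ∈ M, ∀ y ∈ M, ‖X i x - X i y‖ ≤ L * ‖x - y‖) {u : Control k}
    {x : Rn n} {η : C(Icc (0 : ℝ) 1, Rn n)} (h : IsSolution M X u x η) :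
    endMap M X x u = η ⟨1, right_mem_Icc.2 zero_le_one⟩ := by
  rw [SubRiem.endMap_eq hX hlip ((isSolution_iff hX).1 h), extendCurve_of_mem]

theorem zero_mem_endDomain {M : Set (Rn n)} {X : Fin k → Rn n → Rn n}
    (hX : ∀ i, ContDiffOn ℝ ∞ (X i) M) {x : Rn n} (hx : x ∈ M) : 0 ∈ endDomain M X x := by
  refine ⟨fun _ => x, (isControlledCurve_iff hX).2 ⟨rfl, control_integrableOn 0,
    continuousOn_const, fun _ _ => hx, fun s hs t ht => ?_⟩⟩
  rw [sub_self, ← intervalIntegral.integral_zero (E := Rn n) (a := s) (b := t) (μ := volume)]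
  refine intervalIntegral.integral_congr_ae ?_
  filter_upwards [ae_of_ae_restrict_Icc (Lp.coeFn_zero (Rn k) 1
    (volume.restrict (Icc (0 : ℝ) 1))) hs ht] with r hr hrst
  rw [hr hrst, Pi.zero_apply, map_zero]

end Trajectories

/-! ### Smooth dependence on the initial value and the control -/

section SmoothDependence

variable {n k : ℕ}

/-- The shape of the defect in a fixed point equation that is affine in the parameters. -/
theorem contDiffAt_sub_add_bilinear {A L W Y : Type} [NormedAddCommGroup A] [NormedSpace ℝ A]
    [NormedAddCommGroup L] [NormedSpace ℝ L] [NormedAddCommGroup W] [NormedSpace ℝ W]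
    [NormedAddCommGroup Y] [NormedSpace ℝ Y] (c : A →L[ℝ] Y) (B : W →L[ℝ] L →L[ℝ] Y) {S : Y → W}
    {q : (A × L) × Y} (hS : ContDiffAt ℝ ∞ S q.2) :
    ContDiffAt ℝ ∞ (fun q : (A × L) × Y => q.2 - (c q.1.1 + B (S q.2) q.1.2)) q := by
  have h2 : ContDiffAt ℝ ∞ (fun q : (A × L) × Y => S q.2) q := hS.comp q contDiffAt_snd
  have h3 : ContDiffAt ℝ ∞ (fun q : (A × L) × Y => B (S q.2)) q :=
    B.contDiff.contDiffAt.comp q h2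
  fun_prop

theorem hasFDerivAt_bilinear_comp {L W Y : Type}
    [NormedAddCommGroup L] [NormedSpace ℝ L] [NormedAddCommGroup W] [NormedSpace ℝ W]
    [NormedAddCommGroup Y] [NormedSpace ℝ Y] (B : W →L[ℝ] L →L[ℝ] Y) {S : Y → W}
    {S' : Y →L[ℝ] W} {η : Y} (hS : HasFDerivAt S S' η) (u : L) :
    HasFDerivAt (fun p : Y × L => B (S p.1) p.2)
      ((B.flip u ∘L S') ∘L ContinuousLinearMap.fst ℝ Y L +
        B (S η) ∘L ContinuousLinearMap.snd ℝ Y L) (η, u) := by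
  have h1 : HasFDerivAt (fun p : Y × L => S p.1) (S' ∘L ContinuousLinearMap.fst ℝ Y L) (η, u) :=
    HasFDerivAt.comp (g := S) (η, u) hS hasFDerivAt_fst
  have h2 : HasFDerivAt (fun p : Y × L => B (S p.1))
      (B ∘L S' ∘L ContinuousLinearMap.fst ℝ Y L) (η, u) := B.hasFDerivAt.comp (η, u) h1
  refine (h2.clm_apply (hasFDerivAt_snd (p := (η, u)))).congr_fderiv ?_
  ext p <;> simp [add_comm]

/-- The embedding of a normed space into its continuous curves, as constant curves. -/
noncomputable def constCurve (E : Type) [NormedAddCommGroup E] [NormedSpace ℝ E] :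
    E →L[ℝ] C(Icc (0 : ℝ) 1, E) :=
  LinearMap.mkContinuous
    { toFun := fun x => ContinuousMap.const _ x
      map_add' := fun x y => by ext1 t; simp
      map_smul' := fun c x => by ext1 t; simp } 1 fun x => by
    refine (ContinuousMap.norm_le _ (by positivity)).2 fun t => ?_
    simp

/-- The right-hand side of the control equation linearized along the curve `η`, as an operator on
variations of `η`. -/
noncomputable def linearizedField (X : Fin k → Rn n → Rn n) (u : Control k)
    (η : C(Icc (0 : ℝ) 1, Rn n)) : C(Icc (0 : ℝ) 1, Rn n) →L[ℝ] C(Icc (0 : ℝ) 1, Rn n) :=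
  (volterra (ContinuousLinearMap.id ℝ (Rn k →L[ℝ] Rn n))).flip u ∘L
    pointwise _ (ContinuousLinearMap.id ℝ (Rn n →L[ℝ] Rn k →L[ℝ] Rn n))
      (superpose _ (fderiv ℝ (velocity X)) η)

/-- The kernel of the linearized equation is dominated by an integrable function of time. -/
theorem norm_linearizedField_le (X : Fin k → Rn n → Rn n) (u : Control k)
    (η ξ : C(Icc (0 : ℝ) 1, Rn n)) (t : Icc (0 : ℝ) 1) :
    ‖linearizedField X u η ξ t‖ ≤ ∫ s in (0 : ℝ)..t,
      (‖superpose (Icc (0 : ℝ) 1) (fderiv ℝ (velocity X)) η‖ * ‖u s‖) * ‖extendCurve ξ s‖ := by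
  have hu := intervalIntegrable_of_mem_Icc (control_integrableOn u).norm
    (left_mem_Icc.2 zero_le_one) t.2
  refine intervalIntegral.norm_integral_le_of_norm_le t.2.1 (Eventually.of_forall fun s _ => ?_)
    ((hu.const_mul _).mul_continuousOn (continuous_extendCurve ξ).norm.continuousOn)
  have h1 := ContinuousLinearMap.le_opNorm₂
    (superpose (Icc (0 : ℝ) 1) (fderiv ℝ (velocity X)) η (projIcc 0 1 zero_le_one s))
    (extendCurve ξ s) (u s)
  refine h1.trans ?_
  rw [mul_right_comm]
  gcongr
  exact ContinuousMap.norm_coe_le_norm _ _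

theorem isInvertible_one_sub_linearizedField (X : Fin k → Rn n → Rn n) (u : Control k)
    (η : C(Icc (0 : ℝ) 1, Rn n)) :
    (ContinuousLinearMap.id ℝ _ - linearizedField X u η).IsInvertible := by
  refine isInvertible_one_sub_of_norm_le_integral _ ?_ (fun s => ?_)
    (norm_linearizedField_le X u η)
  · exact (intervalIntegrable_of_mem_Icc (control_integrableOn u).norm
      (left_mem_Icc.2 zero_le_one) (right_mem_Icc.2 zero_le_one)).const_mul _
  · positivity

/-- The defect of a curve `η` in the control equation with initial value `x` and control `u`. -/
noncomputable def defect (X : Fin k → Rn n → Rn n)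
    (q : (Rn n × Control k) × C(Icc (0 : ℝ) 1, Rn n)) : C(Icc (0 : ℝ) 1, Rn n) :=
  q.2 - (constCurve (Rn n) q.1.1 +
    volterra (ContinuousLinearMap.id ℝ _) (superpose _ (velocity X) q.2) q.1.2)

theorem contDiffAt_defect {M : Set (Rn n)} (hMo : IsOpen M) {X : Fin k → Rn n → Rn n}
    (hX : ∀ i, ContDiffOn ℝ ∞ (X i) M) {q : (Rn n × Control k) × C(Icc (0 : ℝ) 1, Rn n)}
    (hq : ∀ t, q.2 t ∈ M) : ContDiffAt ℝ ∞ (defect X) q := by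
  have h1 : ContDiffAt ℝ ∞ (superpose (Icc (0 : ℝ) 1) (velocity X)) q.2 :=
    (contDiffOn_superpose hMo (contDiffOn_velocity hX)).contDiffAt
      ((isOpen_forall_mem hMo).mem_nhds hq)
  have h2 := contDiffAt_sub_add_bilinear (constCurve (Rn n))
    (volterra (ContinuousLinearMap.id ℝ (Rn k →L[ℝ] Rn n))) (q := q) h1
  have e : defect X = fun q : (Rn n × Control k) × C(Icc (0 : ℝ) 1, Rn n) =>
      q.2 - (constCurve (Rn n) q.1.1 +
        volterra (ContinuousLinearMap.id ℝ _) (superpose _ (velocity X) q.2) q.1.2) := rfl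
  rw [e]
  exact h2

theorem hasFDerivAt_control_term {M : Set (Rn n)} (hMo : IsOpen M) {X : Fin k → Rn n → Rn n}
    (hX : ∀ i, ContDiffOn ℝ ∞ (X i) M) {η : C(Icc (0 : ℝ) 1, Rn n)} (hη : ∀ t, η t ∈ M)
    (u : Control k) :
    HasFDerivAt (fun p : C(Icc (0 : ℝ) 1, Rn n) × Control k =>
        volterra (ContinuousLinearMap.id ℝ _) (superpose _ (velocity X) p.1) p.2)
      (linearizedField X u η ∘L ContinuousLinearMap.fst ℝ _ _ +
        volterra (ContinuousLinearMap.id ℝ _) (superpose _ (velocity X) η) ∘L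
          ContinuousLinearMap.snd ℝ _ _) (η, u) := by
  exact hasFDerivAt_bilinear_comp (volterra (ContinuousLinearMap.id ℝ _))
    (hasFDerivAt_superpose hMo (contDiffOn_velocity hX) hη) u

theorem isSolution_iff_defect {M : Set (Rn n)} {X : Fin k → Rn n → Rn n} {u : Control k}
    {x : Rn n} {η : C(Icc (0 : ℝ) 1, Rn n)} (hη : ∀ t, η t ∈ M) :
    IsSolution M X u x η ↔ defect X ((x, u), η) = 0 := by
  rw [defect, sub_eq_zero]
  exact ⟨fun h => h.eq, fun h => ⟨hη, h⟩⟩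

/-- Smooth dependence of the trajectory on the initial value and on the control. -/
theorem exists_contDiffAt_isSolution {M : Set (Rn n)} (hMo : IsOpen M) {X : Fin k → Rn n → Rn n}
    (hX : ∀ i, ContDiffOn ℝ ∞ (X i) M) {u : Control k} {x : Rn n} {η : C(Icc (0 : ℝ) 1, Rn n)}
    (h : IsSolution M X u x η) :
    ∃ Γ : Rn n × Control k → C(Icc (0 : ℝ) 1, Rn n), ContDiffAt ℝ ∞ Γ (x, u) ∧ Γ (x, u) = η ∧
      ∀ᶠ p in 𝓝 (x, u), IsSolution M X p.2 p.1 (Γ p) := by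
  have hd := contDiffAt_defect hMo hX (q := ((x, u), η)) h.mem
  have hinv : (fderiv ℝ (defect X) ((x, u), η) ∘L
      ContinuousLinearMap.inr ℝ (Rn n × Control k) C(Icc (0 : ℝ) 1, Rn n)).IsInvertible := by
    have e1 := (hd.differentiableAt (by simp)).hasFDerivAt.comp η
      (hasFDerivAt_prodMk_right (𝕜 := ℝ) (x, u) η)
    have e2 : HasFDerivAt (defect X ∘ fun η => ((x, u), η))
        (ContinuousLinearMap.id ℝ _ - linearizedField X u η) η := by
      have e3 := (hasFDerivAt_control_term hMo hX h.mem u).comp η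
        (hasFDerivAt_prodMk_left (𝕜 := ℝ) η u)
      refine ((hasFDerivAt_id η).sub (e3.const_add (constCurve (Rn n) x))).congr_fderiv ?_
      ext p t
      simp
    rw [e1.unique e2]
    exact isInvertible_one_sub_linearizedField X u η
  have h0 : defect X ((x, u), η) = 0 := (isSolution_iff_defect h.mem).1 h
  have hs := hd.contDiffAt_implicitFunction (by simp) hinv
  have hself := hd.implicitFunction_apply_self (by simp) hinv
  refine ⟨_, hs, hself, ?_⟩
  have hM : ∀ᶠ p in 𝓝 (x, u), ∀ t, hd.implicitFunction (by simp) hinv p t ∈ M := by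
    refine hs.continuousAt.eventually ((isOpen_forall_mem hMo).mem_nhds ?_)
    rw [hself]
    exact h.mem
  filter_upwards [hM, hd.eventually_apply_implicitFunction (by simp) hinv] with p hp1 hp2
  exact (isSolution_iff_defect hp1).2 (hp2.trans h0)

/-- The variational equation. -/
theorem fderiv_isSolution_eq {M : Set (Rn n)} (hMo : IsOpen M) {X : Fin k → Rn n → Rn n}
    (hX : ∀ i, ContDiffOn ℝ ∞ (X i) M) {u : Control k} {x : Rn n}
    {Γ : Control k → C(Icc (0 : ℝ) 1, Rn n)} (hd : DifferentiableAt ℝ Γ u)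
    (hΓ : ∀ᶠ v in 𝓝 u, IsSolution M X v x (Γ v)) (v : Control k) :
    fderiv ℝ Γ u v = linearizedField X u (Γ u) (fderiv ℝ Γ u v) +
      volterra (ContinuousLinearMap.id ℝ _) (superpose _ (velocity X) (Γ u)) v := by
  have h1 := HasFDerivAt.comp (f := fun v => (Γ v, v)) u
    (hasFDerivAt_control_term hMo hX hΓ.self_of_nhds.mem u) (hd.hasFDerivAt.prodMk (hasFDerivAt_id u))
  have h2 := (h1.const_add (constCurve (Rn n) x)).congr_of_eventuallyEq (f₁ := Γ) (by
    filter_upwards [hΓ] with v hv using hv.eq)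
  have h3 := congrArg (fun T => T v) (h2.fderiv)
  simpa using h3

end SmoothDependence

/-! ### Differentiability of the endpoint map and the image of its derivative -/

section EndpointMap

variable {n k : ℕ} {M : Set (Rn n)} {X : Fin k → Rn n → Rn n}

theorem exists_isSolution_of_mem_endDomain (hX : ∀ i, ContDiffOn ℝ ∞ (X i) M) {x : Rn n}
    {u : Control k} (hu : u ∈ endDomain M X x) : ∃ η, IsSolution M X u x η := by
  obtain ⟨γ, hγ⟩ := hu
  obtain ⟨η, hη, -⟩ := exists_isSolution_of_isControlledCurve hX hγ
  exact ⟨η, hη⟩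

theorem IsSolution.mem_endDomain (hX : ∀ i, ContDiffOn ℝ ∞ (X i) M) {x : Rn n}
    {u : Control k} {η : C(Icc (0 : ℝ) 1, Rn n)} (h : IsSolution M X u x η) :
    u ∈ endDomain M X x := ⟨_, (isSolution_iff hX).1 h⟩

/-- Smooth dependence of the trajectory on the control alone. -/
theorem exists_contDiffAt_trajectory (hMo : IsOpen M) (hX : ∀ i, ContDiffOn ℝ ∞ (X i) M) {x : Rn n}
    {u : Control k} (hu : u ∈ endDomain M X x) :
    ∃ Γ : Control k → C(Icc (0 : ℝ) 1, Rn n), ContDiffAt ℝ ∞ Γ u ∧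
      ∀ᶠ v in 𝓝 u, IsSolution M X v x (Γ v) := by
  obtain ⟨η, hη⟩ := exists_isSolution_of_mem_endDomain hX hu
  obtain ⟨Γ, h1, -, h3⟩ := exists_contDiffAt_isSolution hMo hX hη
  have hc : ContDiffAt ℝ ∞ (fun v : Control k => (x, v)) u := by fun_prop
  exact ⟨fun v => Γ (x, v), h1.comp u hc, hc.continuousAt.eventually h3⟩

theorem isOpen_endDomain (hMo : IsOpen M) (hX : ∀ i, ContDiffOn ℝ ∞ (X i) M) (x : Rn n) :
    IsOpen (endDomain M X x) := by
  refine isOpen_iff_mem_nhds.2 fun u hu => ?_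
  obtain ⟨Γ, -, h⟩ := exists_contDiffAt_trajectory hMo hX hu
  filter_upwards [h] with v hv using hv.mem_endDomain hX

theorem endMap_eventuallyEq (hX : ∀ i, ContDiffOn ℝ ∞ (X i) M)
    (hlip : ∃ L : ℝ, ∀ i, ∀ x ∈ M, ∀ y ∈ M, ‖X i x - X i y‖ ≤ L * ‖x - y‖) {x : Rn n}
    {u : Control k} {Γ : Control k → C(Icc (0 : ℝ) 1, Rn n)}
    (h : ∀ᶠ v in 𝓝 u, IsSolution M X v x (Γ v)) :
    endMap M X x =ᶠ[𝓝 u] fun v =>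
      ContinuousMap.evalCLM ℝ (⟨1, right_mem_Icc.2 zero_le_one⟩ : Icc (0 : ℝ) 1) (Γ v) := by
  filter_upwards [h] with v hv using hv.endMap_eq hX hlip

theorem contDiffAt_endMap (hMo : IsOpen M) (hX : ∀ i, ContDiffOn ℝ ∞ (X i) M)
    (hlip : ∃ L : ℝ, ∀ i, ∀ x ∈ M, ∀ y ∈ M, ‖X i x - X i y‖ ≤ L * ‖x - y‖) {x : Rn n}
    {u : Control k} (hu : u ∈ endDomain M X x) : ContDiffAt ℝ ∞ (endMap M X x) u := by
  obtain ⟨Γ, h1, h2⟩ := exists_contDiffAt_trajectory hMo hX hu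
  refine ContDiffAt.congr_of_eventuallyEq ?_ (endMap_eventuallyEq hX hlip h2)
  exact (ContinuousMap.evalCLM ℝ _).contDiff.contDiffAt.comp u h1

/-- The endpoint depends continuously on the initial value. -/
theorem eventually_mem_endDomain_and_endMap_mem (hMo : IsOpen M)
    (hX : ∀ i, ContDiffOn ℝ ∞ (X i) M)
    (hlip : ∃ L : ℝ, ∀ i, ∀ x ∈ M, ∀ y ∈ M, ‖X i x - X i y‖ ≤ L * ‖x - y‖) {x : Rn n}
    {u : Control k} (hu : u ∈ endDomain M X x) {N : Set (Rn n)} (hN : N ∈ 𝓝 (endMap M X x u)) :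
    ∀ᶠ y in 𝓝 x, u ∈ endDomain M X y ∧ endMap M X y u ∈ N := by
  obtain ⟨η, hη⟩ := exists_isSolution_of_mem_endDomain hX hu
  obtain ⟨Γ, h1, h2, h3⟩ := exists_contDiffAt_isSolution hMo hX hη
  have hc : ContinuousAt (fun y : Rn n => (y, u)) x := by fun_prop
  have hΓ : ContinuousAt (fun y : Rn n =>
      Γ (y, u) (⟨1, right_mem_Icc.2 zero_le_one⟩ : Icc (0 : ℝ) 1)) x := by
    have h4 : ContinuousAt (fun y : Rn n => Γ (y, u)) x :=
      ContinuousAt.comp (g := Γ) h1.continuousAt hc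
    exact (ContinuousMap.evalCLM ℝ
      (⟨1, right_mem_Icc.2 zero_le_one⟩ : Icc (0 : ℝ) 1)).continuous.continuousAt.comp h4
  have hN' : N ∈ 𝓝 (Γ (x, u) (⟨1, right_mem_Icc.2 zero_le_one⟩ : Icc (0 : ℝ) 1)) := by
    rwa [h2, ← hη.endMap_eq hX hlip]
  filter_upwards [hc.eventually h3, hΓ.eventually hN'] with y hy1 hy2
  refine ⟨hy1.mem_endDomain hX, ?_⟩
  rw [IsSolution.endMap_eq hX hlip hy1]
  exact hy2

/-- The control with the constant value `(1 - τ)⁻¹ w` on `(τ, 1]` and `0` before. -/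
noncomputable def lateControl (τ : ℝ) (w : Rn k) : Control k :=
  indicatorConstLp 1 (measurableSet_Ioc (a := τ) (b := 1))
    (measure_ne_top (volume.restrict (Icc (0 : ℝ) 1)) _) ((1 - τ)⁻¹ • w)

theorem norm_lateControl_le {τ : ℝ} (hτ : τ < 1) (w : Rn k) : ‖lateControl τ w‖ ≤ ‖w‖ := by
  rw [lateControl, norm_indicatorConstLp one_ne_zero ENNReal.one_ne_top]
  have h1 : 0 < 1 - τ := sub_pos.2 hτ
  have h2 : (volume.restrict (Icc (0 : ℝ) 1)).real (Ioc τ 1) ≤ 1 - τ := by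
    have := measureReal_mono (μ := (volume : Measure ℝ))
      (inter_subset_left : Ioc τ 1 ∩ Icc (0 : ℝ) 1 ⊆ Ioc τ 1) (by simp)
    rw [measureReal_restrict_apply measurableSet_Ioc]
    simpa [hτ.le] using this
  rw [norm_smul, norm_inv, Real.norm_of_nonneg h1.le]
  simp only [ENNReal.toReal_one, div_one, Real.rpow_one]
  calc (1 - τ)⁻¹ * ‖w‖ * (volume.restrict (Icc (0 : ℝ) 1)).real (Ioc τ 1)
      ≤ (1 - τ)⁻¹ * ‖w‖ * (1 - τ) := by gcongr
    _ = ‖w‖ := by field_simp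

theorem volterra_lateControl_of_le {τ : ℝ} (w : Rn k)
    (A : C(Icc (0 : ℝ) 1, Rn k →L[ℝ] Rn n)) {t : Icc (0 : ℝ) 1} (ht : (t : ℝ) ≤ τ) :
    volterra (ContinuousLinearMap.id ℝ _) A (lateControl τ w) t = 0 := by
  rw [volterra_apply, ← intervalIntegral.integral_zero (E := Rn n) (a := (0 : ℝ)) (b := t)
    (μ := volume)]
  refine intervalIntegral.integral_congr_ae ?_
  have hae : lateControl τ w =ᵐ[volume.restrict (Icc (0 : ℝ) 1)]
      (Ioc τ 1).indicator fun _ => (1 - τ)⁻¹ • w := indicatorConstLp_coeFn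
  filter_upwards [ae_of_ae_restrict_Icc hae (left_mem_Icc.2 zero_le_one) t.2]
    with s hs hst
  rw [uIoc_of_le t.2.1] at hst
  have : s ∉ Ioc τ 1 := fun h => absurd (hst.2.trans ht) (not_le.2 h.1)
  rw [hs (by rwa [uIoc_of_le t.2.1]), indicator_of_notMem this, map_zero]

theorem volterra_lateControl_one {τ : ℝ} (hτ : τ ∈ Ico (0 : ℝ) 1) (w : Rn k)
    (A : C(Icc (0 : ℝ) 1, Rn k →L[ℝ] Rn n)) :
    volterra (ContinuousLinearMap.id ℝ _) A (lateControl τ w) ⟨1, right_mem_Icc.2 zero_le_one⟩ =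
      ∫ s in τ..1, extendCurve A s ((1 - τ)⁻¹ • w) := by
  have h0 : (0 : ℝ) ∈ Icc (0 : ℝ) 1 := left_mem_Icc.2 zero_le_one
  have h1 : (1 : ℝ) ∈ Icc (0 : ℝ) 1 := right_mem_Icc.2 zero_le_one
  have hτ' : τ ∈ Icc (0 : ℝ) 1 := Ico_subset_Icc_self hτ
  have hint := integrable_apply_extendCurve (ContinuousLinearMap.id ℝ _) A
    (control_integrableOn (lateControl τ w))
  have hz := volterra_lateControl_of_le w A (t := ⟨τ, hτ'⟩) le_rfl
  rw [volterra_apply] at hz ⊢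
  rw [← intervalIntegral.integral_add_adjacent_intervals
    (intervalIntegrable_of_mem_Icc hint h0 hτ') (intervalIntegrable_of_mem_Icc hint hτ' h1), hz,
    zero_add]
  refine intervalIntegral.integral_congr_ae ?_
  have hae : lateControl τ w =ᵐ[volume.restrict (Icc (0 : ℝ) 1)]
      (Ioc τ 1).indicator fun _ => (1 - τ)⁻¹ • w := indicatorConstLp_coeFn
  filter_upwards [ae_of_ae_restrict_Icc hae hτ' h1] with s hs hst
  have hs' := hs hst
  rw [uIoc_of_le hτ.2.le] at hst
  rw [hs', indicator_of_mem hst]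
  rfl

/-- A late control moves the endpoint, to first order, in the direction of the velocity at the
endpoint, up to an arbitrarily small error. -/
theorem exists_norm_fderiv_endMap_sub_velocity_lt (hMo : IsOpen M)
    (hX : ∀ i, ContDiffOn ℝ ∞ (X i) M)
    (hlip : ∃ L : ℝ, ∀ i, ∀ x ∈ M, ∀ y ∈ M, ‖X i x - X i y‖ ≤ L * ‖x - y‖) {x : Rn n}
    {u : Control k} (hu : u ∈ endDomain M X x) (w : Rn k) {ε : ℝ} (hε : 0 < ε) :
    ∃ v, ‖fderiv ℝ (endMap M X x) u v - velocity X (endMap M X x u) w‖ < ε := by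
  have h0 : (0 : ℝ) ∈ Icc (0 : ℝ) 1 := left_mem_Icc.2 zero_le_one
  have h1 : (1 : ℝ) ∈ Icc (0 : ℝ) 1 := right_mem_Icc.2 zero_le_one
  obtain ⟨Γ, hΓ, hsol⟩ := exists_contDiffAt_trajectory hMo hX hu
  have hΓd := hΓ.differentiableAt (by simp)
  set A := superpose (Icc (0 : ℝ) 1) (velocity X) (Γ u) with hA
  set D := fderiv ℝ Γ u with hD
  have hfd : ∀ v, fderiv ℝ (endMap M X x) u v = D v ⟨1, h1⟩ := fun v => by
    rw [(endMap_eventuallyEq hX hlip hsol).fderiv_eq]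
    have := ((ContinuousMap.evalCLM ℝ (⟨1, h1⟩ : Icc (0 : ℝ) 1)).hasFDerivAt.comp u
      hΓd.hasFDerivAt).fderiv
    exact congrArg (fun T => T v) this
  have hend : velocity X (endMap M X x u) w = extendCurve A 1 w := by
    rw [(endMap_eventuallyEq hX hlip hsol).self_of_nhds, extendCurve_of_mem A h1, hA,
      superpose_apply (contDiffOn_velocity hX).continuousOn hsol.self_of_nhds.mem]
    rfl
  set c := ‖superpose (Icc (0 : ℝ) 1) (fderiv ℝ (velocity X)) (Γ u)‖ with hc
  set a : ℝ → ℝ := fun s => c * ‖u s‖ with ha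
  have hcn : 0 ≤ c := norm_nonneg _
  have haI : IntegrableOn a (Icc 0 1) := (control_integrableOn u).norm.const_mul _
  have ha0 : ∀ s, 0 ≤ a s := fun s => by positivity
  -- the two small quantities: the tail of `a`, and the oscillation of `A` near time `1`
  have hδ : 0 < ε / (2 * (‖D‖ * ‖w‖ + ‖w‖ + 1)) := by positivity
  set δ := ε / (2 * (‖D‖ * ‖w‖ + ‖w‖ + 1)) with hδdef
  have t1 := tendsto_integral_tail haI
  obtain ⟨r, hr, hball⟩ := Metric.continuousAt_iff.1
    ((continuous_extendCurve A).continuousAt (x := 1)) δ hδ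
  -- `1 - r < τ` keeps `[τ, 1]` within the range where `A` oscillates by less than `δ`
  obtain ⟨τ, hτ1, hτ2, hτ3⟩ := ((t1.eventually (gt_mem_nhds hδ)).and
    ((Ioo_mem_nhdsLT (show max 0 (1 - r) < 1 by simp [hr])))).exists
  have hτ : τ ∈ Ico (0 : ℝ) 1 := ⟨(le_max_left _ _).trans hτ2.le, hτ3⟩
  have hτ' : τ ∈ Icc (0 : ℝ) 1 := Ico_subset_Icc_self hτ
  set v := lateControl τ w with hv
  have hξ : D v = linearizedField X u (Γ u) (D v) + volterra (ContinuousLinearMap.id ℝ _) A v :=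
    fderiv_isSolution_eq hMo hX hΓd hsol v
  have hξn : ‖D v‖ ≤ ‖D‖ * ‖w‖ := (D.le_opNorm v).trans (by
    gcongr
    exact norm_lateControl_le hτ.2 w)
  -- the variation vanishes up to time `τ`
  have hzero : ∀ t ∈ Icc 0 τ, ‖extendCurve (D v) t‖ ≤ 0 := by
    refine nonpos_of_le_integral (intervalIntegrable_of_mem_Icc haI h0 h1) ha0 hτ.2.le
      (continuous_extendCurve _).norm.continuousOn fun t ht => ?_
    have ht' : t ∈ Icc (0 : ℝ) 1 := ⟨ht.1, ht.2.trans hτ.2.le⟩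
    have e := congrArg (fun ξ : C(Icc (0 : ℝ) 1, Rn n) => ξ ⟨t, ht'⟩) hξ
    simp only [ContinuousMap.add_apply] at e
    rw [volterra_lateControl_of_le w A (t := ⟨t, ht'⟩) ht.2, add_zero] at e
    rw [extendCurve_of_mem _ ht', e]
    exact norm_linearizedField_le X u (Γ u) (D v) ⟨t, ht'⟩
  have hfirst : ‖linearizedField X u (Γ u) (D v) ⟨1, h1⟩‖ ≤ δ * (‖D‖ * ‖w‖) := by
    refine (norm_linearizedField_le X u (Γ u) (D v) ⟨1, h1⟩).trans ?_
    have hi : IntegrableOn (fun s => a s * ‖extendCurve (D v) s‖) (Icc 0 1) :=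
      haI.mul_continuousOn (continuous_extendCurve _).norm.continuousOn isCompact_Icc
    change ∫ s in (0 : ℝ)..1, a s * ‖extendCurve (D v) s‖ ≤ _
    rw [← intervalIntegral.integral_add_adjacent_intervals
      (intervalIntegrable_of_mem_Icc hi h0 hτ') (intervalIntegrable_of_mem_Icc hi hτ' h1)]
    have z : ∫ s in (0 : ℝ)..τ, a s * ‖extendCurve (D v) s‖ = 0 := by
      refine (intervalIntegral.integral_congr (g := fun _ => 0) fun s hs => ?_).trans (by simp)
      rw [uIcc_of_le hτ.1] at hs
      simp only [le_antisymm (hzero s hs) (norm_nonneg _), mul_zero]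
    rw [z, zero_add]
    calc ∫ s in τ..1, a s * ‖extendCurve (D v) s‖ ≤ ∫ s in τ..1, a s * (‖D‖ * ‖w‖) := by
          refine intervalIntegral.integral_mono_on hτ.2.le
            (intervalIntegrable_of_mem_Icc hi hτ' h1)
            ((intervalIntegrable_of_mem_Icc haI hτ' h1).mul_const _) fun s hs => ?_
          exact mul_le_mul_of_nonneg_left ((norm_extendCurve_le _ s).trans hξn) (ha0 s)
      _ ≤ δ * (‖D‖ * ‖w‖) := by
          rw [intervalIntegral.integral_mul_const]
          gcongr
  have hsecond : ‖volterra (ContinuousLinearMap.id ℝ _) A v ⟨1, h1⟩ - extendCurve A 1 w‖ ≤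
      δ * ‖w‖ := by
    have hp : 0 < 1 - τ := sub_pos.2 hτ.2
    have e1 : extendCurve A 1 w = ∫ _s in τ..1, extendCurve A 1 ((1 - τ)⁻¹ • w) := by
      rw [intervalIntegral.integral_const, map_smul, smul_smul, mul_inv_cancel₀ hp.ne', one_smul]
    have c1 : Continuous fun s => extendCurve A s ((1 - τ)⁻¹ • w) :=
      (continuous_extendCurve A).clm_apply continuous_const
    rw [hv, volterra_lateControl_one hτ, e1, ← intervalIntegral.integral_sub
      (c1.intervalIntegrable _ _) (continuous_const.intervalIntegrable _ _)]
    refine (intervalIntegral.norm_integral_le_of_norm_le_const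
      (C := δ * ‖(1 - τ)⁻¹ • w‖) fun s hs => ?_).trans_eq ?_
    · rw [uIoc_of_le hτ.2.le] at hs
      rw [← sub_apply]
      refine ContinuousLinearMap.le_of_opNorm_le _ ?_ _
      have hlt := hball (x := s) (by
        have := (le_max_right 0 (1 - r)).trans_lt (hτ2.trans hs.1)
        rw [Real.dist_eq, abs_lt]
        constructor <;> linarith [hs.2])
      rw [dist_eq_norm] at hlt
      exact hlt.le
    · rw [norm_smul, norm_inv, Real.norm_of_nonneg hp.le, abs_of_nonneg hp.le]
      field_simp
  refine ⟨v, ?_⟩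
  have e := congrArg (fun ξ : C(Icc (0 : ℝ) 1, Rn n) => ξ ⟨1, h1⟩) hξ
  simp only [ContinuousMap.add_apply] at e
  rw [hfd, hend, e, add_sub_assoc]
  calc _ ≤ δ * (‖D‖ * ‖w‖) + δ * ‖w‖ := (norm_add_le _ _).trans (add_le_add hfirst hsecond)
    _ < 2 * δ * (‖D‖ * ‖w‖ + ‖w‖ + 1) := by
        have : 0 ≤ ‖D‖ * ‖w‖ := by positivity
        nlinarith [norm_nonneg w]
    _ = ε := by
        rw [hδdef]
        field_simp

/-- The image of the derivative of the endpoint map contains the distribution at the endpoint. -/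
theorem span_le_range_fderiv_endMap (hMo : IsOpen M) (hX : ∀ i, ContDiffOn ℝ ∞ (X i) M)
    (hlip : ∃ L : ℝ, ∀ i, ∀ x ∈ M, ∀ y ∈ M, ‖X i x - X i y‖ ≤ L * ‖x - y‖) {x : Rn n}
    {u : Control k} (hu : u ∈ endDomain M X x) :
    Submodule.span ℝ (range fun i => X i (endMap M X x u)) ≤
      LinearMap.range (fderiv ℝ (endMap M X x) u).toLinearMap := by
  rw [Submodule.span_le]
  rintro _ ⟨i, rfl⟩
  have hcl : IsClosed (LinearMap.range (fderiv ℝ (endMap M X x) u).toLinearMap : Set (Rn n)) :=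
    Submodule.closed_of_finiteDimensional _
  rw [← hcl.closure_eq, Metric.mem_closure_iff]
  intro ε hε
  obtain ⟨v, hv⟩ := exists_norm_fderiv_endMap_sub_velocity_lt hMo hX hlip hu
    (EuclideanSpace.single i 1) hε
  refine ⟨_, ⟨v, rfl⟩, ?_⟩
  rw [dist_comm, dist_eq_norm]
  simpa [velocity_apply] using hv

end EndpointMap

/-! ### Maximal rank of the endpoint map -/

section MaximalRank

variable {n k : ℕ} {M : Set (Rn n)} {X : Fin k → Rn n → Rn n}

/-- The local vector fields that are tangent to the parametrized submanifold `f : N → ℝⁿ`. -/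
def tangentFields {R : Type} [NormedAddCommGroup R] [NormedSpace ℝ R] (M : Set (Rn n))
    (f : R → Rn n) (N : Set R) : Set (LocalVectorField M) :=
  {V | ∀ s ∈ N, f s ∈ V.dom → V.toFun (f s) ∈ LinearMap.range (fderiv ℝ f s).toLinearMap}

theorem isOpen_setOf_isUnit (R : Type) [NormedAddCommGroup R] [NormedSpace ℝ R] [CompleteSpace R] :
    IsOpen {Q : R →L[ℝ] R | IsUnit Q} := Units.isOpen

/-- A field tangent to an immersion `f` is `f`-related to a differentiable field upstairs. -/
theorem exists_related_field {R : Type} [NormedAddCommGroup R] [NormedSpace ℝ R]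
    [CompleteSpace R] {f : R → Rn n} {N : Set R} (hN : IsOpen N) (hf : ContDiffOn ℝ ∞ f N)
    {P : Rn n →L[ℝ] R} (hP : ∀ s ∈ N, IsUnit (P ∘L fderiv ℝ f s)) {V : LocalVectorField M}
    (hV : V ∈ tangentFields M f N) {s₀ : R} (hs₀ : s₀ ∈ N) (hd : f s₀ ∈ V.dom) :
    ∃ a : R → R, DifferentiableAt ℝ a s₀ ∧
      ∀ᶠ s in 𝓝 s₀, V.toFun (f s) = fderiv ℝ f s (a s) := by
  have hfs : ContDiffAt ℝ ∞ f s₀ := hf.contDiffAt (hN.mem_nhds hs₀)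
  refine ⟨fun s => Ring.inverse (P ∘L fderiv ℝ f s) (P (V.toFun (f s))), ?_, ?_⟩
  · have hf' : ContDiffAt ℝ ∞ (fderiv ℝ f) s₀ := hfs.fderiv_right (by simp)
    have h1 : DifferentiableAt ℝ (fun s => P ∘L fderiv ℝ f s) s₀ :=
      (differentiableAt_const P).clm_comp (hf'.differentiableAt (by simp))
    obtain ⟨U, hU⟩ := hP s₀ hs₀
    have h2 : DifferentiableAt ℝ Ring.inverse (P ∘L fderiv ℝ f s₀) := by
      rw [← hU]
      exact (contDiffAt_ringInverse ℝ U (n := ∞)).differentiableAt (by simp)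
    have h3 : DifferentiableAt ℝ V.toFun (f s₀) :=
      (V.smooth.contDiffAt (V.isOpen_dom.mem_nhds hd)).differentiableAt (by simp)
    have h4 : DifferentiableAt ℝ (fun s => V.toFun (f s)) s₀ :=
      DifferentiableAt.comp (g := V.toFun) s₀ h3 (hfs.differentiableAt (by simp))
    have h5 : DifferentiableAt ℝ (fun s => Ring.inverse (P ∘L fderiv ℝ f s)) s₀ :=
      DifferentiableAt.comp (g := Ring.inverse) s₀ h2 h1
    exact h5.clm_apply (P.differentiableAt.comp s₀ h4)
  · filter_upwards [hN.mem_nhds hs₀, hfs.continuousAt.preimage_mem_nhds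
      (V.isOpen_dom.mem_nhds hd)] with s hs hsd
    obtain ⟨z, hz⟩ := hV s hs hsd
    have e : Ring.inverse (P ∘L fderiv ℝ f s) ((P ∘L fderiv ℝ f s) z) = z := by
      have := Ring.inverse_mul_cancel _ (hP s hs)
      exact congrArg (fun T : R →L[ℝ] R => T z) this
    rw [← hz]
    change fderiv ℝ f s z = fderiv ℝ f s (Ring.inverse (P ∘L fderiv ℝ f s) _)
    exact congrArg _ e.symm

/-- Brackets of fields tangent to an immersed submanifold are tangent to it: in the difference
`DW·V - DV·W` the second derivative of the parametrization cancels by symmetry. -/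
theorem isInvolutive_tangentFields {R : Type} [NormedAddCommGroup R] [NormedSpace ℝ R]
    [CompleteSpace R] {f : R → Rn n} {N : Set R} (hN : IsOpen N) (hf : ContDiffOn ℝ ∞ f N)
    {P : Rn n →L[ℝ] R} (hP : ∀ s ∈ N, IsUnit (P ∘L fderiv ℝ f s)) :
    IsInvolutive (tangentFields M f N) := by
  have key : ∀ V ∈ tangentFields M f N, ∀ s ∈ N, f s ∈ V.dom → ∃ (a : R) (a' : R →L[ℝ] R),
      V.toFun (f s) = fderiv ℝ f s a ∧ ∀ z, fderiv ℝ V.toFun (f s) (fderiv ℝ f s z) =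
        fderiv ℝ (fderiv ℝ f) s z a + fderiv ℝ f s (a' z) := by
    intro V hV s hs hd
    obtain ⟨a, ha, hev⟩ := exists_related_field hN hf hP hV hs hd
    have hfs : ContDiffAt ℝ ∞ f s := hf.contDiffAt (hN.mem_nhds hs)
    have hf' : ContDiffAt ℝ ∞ (fderiv ℝ f) s := hfs.fderiv_right (by simp)
    refine ⟨a s, fderiv ℝ a s, hev.self_of_nhds, fun z => ?_⟩
    have h3 : DifferentiableAt ℝ V.toFun (f s) :=
      (V.smooth.contDiffAt (V.isOpen_dom.mem_nhds hd)).differentiableAt (by simp)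
    have e1 : HasFDerivAt (fun s => V.toFun (f s)) _ s :=
      HasFDerivAt.comp (g := V.toFun) s h3.hasFDerivAt
        (hfs.differentiableAt (by simp)).hasFDerivAt
    have e2 := ((hf'.differentiableAt (by simp)).hasFDerivAt.clm_apply
      ha.hasFDerivAt).congr_of_eventuallyEq hev
    have e3 := congrArg (fun T => T z) (e1.unique e2)
    simpa [add_comm] using e3
  intro V hV W hW s hs hd
  obtain ⟨a, a', ha, ha'⟩ := key V hV s hs hd.1
  obtain ⟨b, b', hb, hb'⟩ := key W hW s hs hd.2
  have hsymm : fderiv ℝ (fderiv ℝ f) s a b = fderiv ℝ (fderiv ℝ f) s b a :=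
    ((hf.contDiffAt (hN.mem_nhds hs)).isSymmSndFDerivAt (by
      rw [minSmoothness_of_isRCLikeNormedField]
      exact WithTop.coe_le_coe.2 le_top)).eq a b
  refine ⟨b' a - a' b, ?_⟩
  change _ = fderiv ℝ W.toFun (f s) (V.toFun (f s)) - fderiv ℝ V.toFun (f s) (W.toFun (f s))
  rw [ha, hb, hb' a, ha' b, hsymm, add_sub_add_left_eq_sub]
  exact map_sub (fderiv ℝ f s) _ _

theorem endMap_mem {x : Rn n} {u : Control k} (hu : u ∈ endDomain M X x) :
    endMap M X x u ∈ M := by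
  have hex : ∃ γ, IsControlledCurve M X u x γ := hu
  rw [endMap, dif_pos hex]
  exact hex.choose_spec.mem 1 (right_mem_Icc.2 zero_le_one)

theorem rankAt_le (f : Control k → Rn n) (u : Control k) : rankAt f u ≤ n := by
  have := Submodule.finrank_le (LinearMap.range (fderiv ℝ f u).toLinearMap)
  simpa [rankAt] using this

/-- Near a control of maximal rank, the endpoint map parametrizes a submanifold to which all
horizontal fields, and hence all their iterated brackets, are tangent. -/
theorem exists_range_fderiv_endMap_eq_top (hMo : IsOpen M) (hX : ∀ i, ContDiffOn ℝ ∞ (X i) M)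
    (hlip : ∃ L : ℝ, ∀ i, ∀ x ∈ M, ∀ y ∈ M, ‖X i x - X i y‖ ≤ L * ‖x - y‖)
    {H : Rn n → Submodule ℝ (Rn n)}
    (hspan : ∀ x ∈ M, H x = Submodule.span ℝ (range fun i => X i x))
    (hH : IsBracketGenerating M H) {x : Rn n} {U : Set (Control k)} (hU : IsOpen U)
    (hne : U.Nonempty) (hUD : U ⊆ endDomain M X x) :
    ∃ u ∈ U, LinearMap.range (fderiv ℝ (endMap M X x) u).toLinearMap = ⊤ := by
  obtain ⟨u, hu, hmax⟩ : ∃ u ∈ U, ∀ v ∈ U, rankAt (endMap M X x) v ≤ rankAt (endMap M X x) u := by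
    have hb : BddAbove (rankAt (endMap M X x) '' U) :=
      ⟨n, by rintro _ ⟨v, -, rfl⟩; exact rankAt_le _ v⟩
    obtain ⟨u, hu, he⟩ := Nat.sSup_mem (hne.image _) hb
    exact ⟨u, hu, fun v hv => he ▸ le_csSup hb ⟨v, hv, rfl⟩⟩
  refine ⟨u, hu, ?_⟩
  set T := fderiv ℝ (endMap M X x) u with hT
  set R := LinearMap.range T.toLinearMap with hR
  -- a finite-dimensional slice through `u` on which the derivative at `u` is the inclusion of `R`
  obtain ⟨σ₀, hσ₀⟩ := T.toLinearMap.rangeRestrict.exists_rightInverse_of_surjective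
    T.toLinearMap.range_rangeRestrict
  let σ : R →L[ℝ] Control k := LinearMap.toContinuousLinearMap σ₀
  have hσ : ∀ s : R, T (σ s) = s := fun s =>
    congrArg Subtype.val (congrArg (fun g : R →ₗ[ℝ] R => g s) hσ₀)
  let P : Rn n →L[ℝ] R := R.orthogonalProjectionOnto
  have hPs : ∀ s : R, P s = s := fun s => R.orthogonalProjectionOnto_mem_subspace_eq_self s
  let f : R → Rn n := fun s => endMap M X x (u + σ s)
  have hσc : ContDiff ℝ ∞ (fun s : R => u + σ s) := contDiff_const.add σ.contDiff
  let N₀ : Set R := {s | u + σ s ∈ U}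
  have hN₀ : IsOpen N₀ := hU.preimage hσc.continuous
  have hf₀ : ContDiffOn ℝ ∞ f N₀ := fun s hs =>
    (ContDiffAt.comp (g := endMap M X x) s (contDiffAt_endMap hMo hX hlip (hUD hs))
      hσc.contDiffAt).contDiffWithinAt
  have hfd : ∀ s ∈ N₀, fderiv ℝ f s = fderiv ℝ (endMap M X x) (u + σ s) ∘L σ := fun s hs =>
    (HasFDerivAt.comp (g := endMap M X x) s
      ((contDiffAt_endMap hMo hX hlip (hUD hs)).differentiableAt (by simp)).hasFDerivAt
      (σ.hasFDerivAt.const_add u)).fderiv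
  let N : Set R := N₀ ∩ (fun s => P ∘L fderiv ℝ f s) ⁻¹' {Q | IsUnit Q}
  have hN : IsOpen N := by
    refine ContinuousOn.isOpen_inter_preimage ?_ hN₀ (isOpen_setOf_isUnit R)
    exact continuousOn_const.clm_comp (hf₀.continuousOn_fderiv_of_isOpen hN₀ (by simp))
  have hf : ContDiffOn ℝ ∞ f N := hf₀.mono inter_subset_left
  have h0 : (0 : R) ∈ N₀ := by simpa [N₀] using hu
  have hfd0 : ∀ s : R, fderiv ℝ f 0 s = s := fun s => by
    rw [hfd 0 h0]
    simpa using hσ s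
  have h0N : (0 : R) ∈ N := by
    refine ⟨h0, ?_⟩
    have : P ∘L fderiv ℝ f 0 = 1 := by
      ext1 s
      change P (fderiv ℝ f 0 s) = s
      rw [hfd0, hPs]
    simp only [mem_preimage, mem_ofPred_eq, this]
    exact isUnit_one
  -- on the slice the rank is still maximal, so nothing is lost by restricting to it
  have hrange : ∀ s ∈ N, LinearMap.range (fderiv ℝ f s).toLinearMap =
      LinearMap.range (fderiv ℝ (endMap M X x) (u + σ s)).toLinearMap := by
    intro s hs
    refine Submodule.eq_of_le_of_finrank_le ?_ ?_
    · rw [hfd s hs.1]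
      rintro _ ⟨z, rfl⟩
      exact ⟨σ z, rfl⟩
    · have hinj : Function.Injective (fderiv ℝ f s).toLinearMap := by
        intro y z hyz
        have hyz' : fderiv ℝ f s y = fderiv ℝ f s z := hyz
        have e : ∀ y, Ring.inverse (P ∘L fderiv ℝ f s) ((P ∘L fderiv ℝ f s) y) = y := fun y =>
          congrArg (fun T : R →L[ℝ] R => T y) (Ring.inverse_mul_cancel _ hs.2)
        rw [← e y, ← e z]
        simp only [ContinuousLinearMap.comp_apply, hyz']
      rw [LinearMap.finrank_range_of_inj hinj]
      exact hmax _ hs.1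
  have hhor : horizontalFields M H ⊆ tangentFields M f N := by
    intro V hV s hs hd
    rw [hrange s hs]
    have h1 := hV (f s) hd
    rw [hspan _ (V.dom_subset hd)] at h1
    exact span_le_range_fderiv_endMap hMo hX hlip (hUD hs.1) h1
  have hlie : lieHull (horizontalFields M H) ⊆ tangentFields M f N :=
    sInter_subset_of_mem ⟨hhor, isInvolutive_tangentFields hN hf fun s hs => hs.2⟩
  have hf0 : f 0 = endMap M X x u := by simp [f]
  have htop := hH (endMap M X x u) (endMap_mem (hUD hu))
  rw [← top_le_iff, ← htop, spanAt, Submodule.span_le]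
  rintro _ ⟨V, hV, hd, rfl⟩
  rw [← hf0] at hd ⊢
  obtain ⟨z, hz⟩ := hlie hV 0 h0N hd
  rw [← hz]
  change fderiv ℝ f 0 z ∈ R
  rw [hfd0]
  exact z.2

end MaximalRank

/-! ### Concatenation of trajectories and openness of the endpoint map -/

section Concatenation

variable {n k : ℕ} {M : Set (Rn n)} {X : Fin k → Rn n → Rn n}

theorem IsTrajectory.mono {u : ℝ → Rn k} {γ : ℝ → Rn n} {a b c d : ℝ}
    (h : IsTrajectory M X u γ a b) (hsub : Icc c d ⊆ Icc a b) : IsTrajectory M X u γ c d :=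
  ⟨h.integrableOn.mono_set hsub, h.continuousOn.mono hsub, fun t ht => h.mem t (hsub ht),
    fun s hs t ht => h.integral_eq s (hsub hs) t (hsub ht)⟩

/-- Affine reparametrization of a trajectory; a negative slope `c` reverses it. -/
theorem IsTrajectory.comp_affine {u : ℝ → Rn k} {γ : ℝ → Rn n} {a b a' b' c d : ℝ}
    (h : IsTrajectory M X u γ a b) (hc : c ≠ 0) (hmap : MapsTo (fun t => c * t + d)
      (Icc a' b') (Icc a b)) :
    IsTrajectory M X (fun t => c • u (c * t + d)) (fun t => γ (c * t + d)) a' b' := by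
  have hcont : Continuous fun t : ℝ => c * t + d := by fun_prop
  refine ⟨?_, h.continuousOn.comp hcont.continuousOn hmap, fun t ht => h.mem _ (hmap ht), ?_⟩
  · have h1 : Integrable ((Icc a b).indicator u) := h.integrableOn.integrable_indicator
      measurableSet_Icc
    have h2 : Integrable fun t => (Icc a b).indicator u (c * t + d) :=
      (h1.comp_add_right d).comp_mul_left' hc
    refine ((h2.integrableOn (s := Icc a' b')).congr_fun (fun t ht => ?_) measurableSet_Icc).smul c
    exact indicator_of_mem (hmap ht) u
  · intro s hs t ht
    rw [← h.integral_eq _ (hmap hs) _ (hmap ht), ← intervalIntegral.smul_integral_comp_mul_add,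
      ← intervalIntegral.integral_smul]
    simp only [map_smul]

theorem IsTrajectory.exists_concat (hX : ∀ i, ContDiffOn ℝ ∞ (X i) M) {u₁ u₂ : ℝ → Rn k}
    {γ₁ γ₂ : ℝ → Rn n} {a b c : ℝ} (h₁ : IsTrajectory M X u₁ γ₁ a b)
    (h₂ : IsTrajectory M X u₂ γ₂ b c) (hab : a ≤ b) (hbc : b ≤ c) (hb : γ₁ b = γ₂ b) :
    ∃ (u : ℝ → Rn k) (γ : ℝ → Rn n), IsTrajectory M X u γ a c ∧ γ a = γ₁ a ∧ γ c = γ₂ c ∧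
      EqOn u u₁ (Icc a b) ∧ EqOn u u₂ (Ioc b c) := by
  let u : ℝ → Rn k := fun t => if t ≤ b then u₁ t else u₂ t
  let γ : ℝ → Rn n := fun t => if t ≤ b then γ₁ t else γ₂ t
  have hu₁ : EqOn u u₁ (Icc a b) := fun t ht => if_pos ht.2
  have hu₂ : EqOn u u₂ (Ioc b c) := fun t ht => if_neg (not_le.2 ht.1)
  have hγ₁ : EqOn γ γ₁ (Icc a b) := fun t ht => if_pos ht.2
  have hγ₂ : EqOn γ γ₂ (Icc b c) := fun t ht => by
    rcases ht.1.eq_or_lt with rfl | hlt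
    · exact (if_pos le_rfl).trans hb
    · exact if_neg (not_le.2 hlt)
  have hcover : Icc a b ∪ Icc b c = Icc a c := Icc_union_Icc_eq_Icc hab hbc
  have hui : IntegrableOn u (Icc a c) := by
    have e : Icc a b ∪ Ioc b c = Icc a c := Icc_union_Ioc_eq_Icc hab hbc
    rw [← e]
    refine IntegrableOn.union (h₁.integrableOn.congr_fun hu₁.symm measurableSet_Icc) ?_
    exact (h₂.integrableOn.mono_set Ioc_subset_Icc_self).congr_fun hu₂.symm measurableSet_Ioc
  have hγc : ContinuousOn γ (Icc a c) := by
    rw [← hcover]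
    exact (h₁.continuousOn.congr hγ₁).union_of_isClosed (h₂.continuousOn.congr hγ₂)
      isClosed_Icc isClosed_Icc
  have hγM : ∀ t ∈ Icc a c, γ t ∈ M := by
    rw [← hcover]
    rintro t (ht | ht)
    · rw [hγ₁ ht]; exact h₁.mem t ht
    · rw [hγ₂ ht]; exact h₂.mem t ht
  have hint := integrableOn_velocity hX hui hγc hγM
  have ha : a ∈ Icc a b := left_mem_Icc.2 hab
  have hbm : b ∈ Icc a b := right_mem_Icc.2 hab
  have hbm' : b ∈ Icc b c := left_mem_Icc.2 hbc
  have hI₁ : ∀ t ∈ Icc a b, ∫ r in a..t, velocity X (γ r) (u r) = γ₁ t - γ₁ a := by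
    intro t ht
    rw [← h₁.integral_eq a ha t ht]
    refine intervalIntegral.integral_congr fun r hr => ?_
    have hr' := uIcc_subset_Icc ha ht hr
    simp only [hu₁ hr', hγ₁ hr']
  have hI₂ : ∀ t ∈ Icc b c, ∫ r in b..t, velocity X (γ r) (u r) = γ₂ t - γ₂ b := by
    intro t ht
    rw [← h₂.integral_eq b hbm' t ht]
    refine intervalIntegral.integral_congr_ae (Eventually.of_forall fun r hr => ?_)
    rw [uIoc_of_le ht.1] at hr
    have hr' : r ∈ Ioc b c := ⟨hr.1, hr.2.trans ht.2⟩
    rw [hu₂ hr', hγ₂ (Ioc_subset_Icc_self hr')]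
  refine ⟨u, γ, isTrajectory_of_forall_eq_add hX (x := γ₁ a) hui hγc hγM ?_, hγ₁ ha,
    hγ₂ (right_mem_Icc.2 hbc), hu₁, hu₂⟩
  intro t ht
  rw [← hcover] at ht
  rcases ht with ht | ht
  · rw [hI₁ t ht, hγ₁ ht]; abel
  · have i₁ := intervalIntegrable_of_mem_Icc hint (s := a) (t := b) ⟨le_rfl, hab.trans hbc⟩
      ⟨hab, hbc⟩
    have i₂ := intervalIntegrable_of_mem_Icc hint (s := b) (t := t) ⟨hab, hbc⟩
      ⟨hab.trans ht.1, ht.2⟩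
    rw [← intervalIntegral.integral_add_adjacent_intervals i₁ i₂, hI₁ b hbm, hI₂ t ht, hγ₂ ht, hb]
    abel

/-- Drive along the first trajectory up to time `τ`, then along the second at increased speed. The
`L¹` norm of the second control is not affected by the speed-up. -/
theorem IsTrajectory.exists_splice (hX : ∀ i, ContDiffOn ℝ ∞ (X i) M) {u₁ u₂ : ℝ → Rn k}
    {γ₁ γ₂ : ℝ → Rn n} {τ : ℝ} (hτ : τ ∈ Ico (0 : ℝ) 1) (h₁ : IsTrajectory M X u₁ γ₁ 0 τ)
    (h₂ : IsTrajectory M X u₂ γ₂ 0 1) (h : γ₁ τ = γ₂ 0) :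
    ∃ (u : ℝ → Rn k) (γ : ℝ → Rn n), IsTrajectory M X u γ 0 1 ∧ γ 0 = γ₁ 0 ∧ γ 1 = γ₂ 1 ∧
      EqOn u u₁ (Icc 0 τ) ∧ ∫ s in τ..1, ‖u s‖ = ∫ s in (0 : ℝ)..1, ‖u₂ s‖ := by
  have hp : 0 < 1 - τ := sub_pos.2 hτ.2
  set c := (1 - τ)⁻¹ with hc
  have hc0 : 0 < c := inv_pos.2 hp
  have e0 : c * τ + -(c * τ) = 0 := by ring
  have e1 : c * 1 + -(c * τ) = 1 := by rw [hc]; field_simp; ring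
  have hmap : MapsTo (fun t => c * t + -(c * τ)) (Icc τ 1) (Icc 0 1) := by
    intro t ht
    constructor
    · rw [← e0]; dsimp only; gcongr; exact ht.1
    · rw [← e1]; dsimp only; gcongr; exact ht.2
  have h₃ := h₂.comp_affine hc0.ne' hmap
  obtain ⟨u, γ, hu, ha, hb, huu, hu'⟩ := h₁.exists_concat hX h₃ hτ.1 hτ.2.le (by
    simp only [e0, h])
  refine ⟨u, γ, hu, ha, hb.trans (by simp only [e1]), huu, ?_⟩
  have : ∫ s in τ..1, ‖u s‖ = ∫ s in τ..1, c * ‖u₂ (c * s + -(c * τ))‖ := by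
    refine intervalIntegral.integral_congr_ae (Eventually.of_forall fun s hs => ?_)
    rw [uIoc_of_le hτ.2.le] at hs
    rw [hu' hs, norm_smul, Real.norm_of_nonneg hc0.le]
  rw [this, intervalIntegral.integral_const_mul, ← smul_eq_mul,
    intervalIntegral.smul_integral_comp_mul_add (fun s => ‖u₂ s‖), e0, e1]

/-- The point `z` can be reached from `y` in `M` by a control of `L¹` norm less than `ε`. -/
def Reach (M : Set (Rn n)) (X : Fin k → Rn n → Rn n) (ε : ℝ) (y z : Rn n) : Prop :=
  ∃ (u : ℝ → Rn k) (γ : ℝ → Rn n), IsTrajectory M X u γ 0 1 ∧ γ 0 = y ∧ γ 1 = z ∧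
    ∫ s in (0 : ℝ)..1, ‖u s‖ < ε

theorem Reach.symm {ε : ℝ} {y z : Rn n} (h : Reach M X ε y z) : Reach M X ε z y := by
  obtain ⟨u, γ, hu, rfl, rfl, hlt⟩ := h
  refine ⟨_, _, hu.comp_affine (c := -1) (d := 1) (a' := 0) (b' := 1) (by norm_num)
    (fun t ht => ⟨by linarith [ht.2], by linarith [ht.1]⟩), by norm_num, by norm_num, ?_⟩
  have e := intervalIntegral.smul_integral_comp_mul_add (a := 0) (b := 1) (fun s => ‖u s‖) (-1) 1
  rw [show (-1 : ℝ) * 0 + 1 = 1 by norm_num, show (-1 : ℝ) * 1 + 1 = 0 by norm_num,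
    intervalIntegral.integral_symm 0 1, smul_eq_mul] at e
  simp only [norm_smul, norm_neg, norm_one, one_mul]
  linarith

theorem Reach.of_tail {u : ℝ → Rn k} {γ : ℝ → Rn n} (h : IsTrajectory M X u γ 0 1) {τ ε : ℝ}
    (hτ : τ ∈ Ico (0 : ℝ) 1) (hε : ∫ s in τ..1, ‖u s‖ < ε) : Reach M X ε (γ τ) (γ 1) := by
  have hp : 0 < 1 - τ := sub_pos.2 hτ.2
  refine ⟨_, _, h.comp_affine (c := 1 - τ) (d := τ) (a' := 0) (b' := 1) hp.ne' ?_, by simp, by simp,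
    ?_⟩
  · intro t ht
    constructor
    · exact add_nonneg (mul_nonneg hp.le ht.1) hτ.1
    · have := mul_le_mul_of_nonneg_left ht.2 hp.le
      dsimp only
      linarith
  · simp only [norm_smul, Real.norm_of_nonneg hp.le]
    rw [intervalIntegral.integral_const_mul, ← smul_eq_mul,
      intervalIntegral.smul_integral_comp_mul_add (fun s => ‖u s‖)]
    simpa using hε

theorem Reach.trans (hX : ∀ i, ContDiffOn ℝ ∞ (X i) M) {ε₁ ε₂ : ℝ} {x y z : Rn n}
    (h₁ : Reach M X ε₁ x y) (h₂ : Reach M X ε₂ y z) : Reach M X (ε₁ + ε₂) x z := by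
  obtain ⟨u₁, γ₁, hu₁, rfl, rfl, hlt₁⟩ := h₁
  obtain ⟨u₂, γ₂, hu₂, h0, rfl, hlt₂⟩ := h₂
  have h₃ := hu₁.comp_affine (c := 2) (d := 0) (a' := 0) (b' := 1 / 2) (by norm_num)
    (fun t ht => ⟨by linarith [ht.1], by linarith [ht.2]⟩)
  obtain ⟨u, γ, hu, ha, hb, huu, hu'⟩ := h₃.exists_splice hX (by constructor <;> norm_num) hu₂ (by
    norm_num [h0])
  refine ⟨u, γ, hu, by simpa using ha, hb, ?_⟩
  have hn : IntegrableOn (fun s => ‖u s‖) (Icc 0 1) := hu.integrableOn.norm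
  rw [← intervalIntegral.integral_add_adjacent_intervals
    (intervalIntegrable_of_mem_Icc hn (t := 1 / 2) (by simp) (by constructor <;> norm_num))
    (intervalIntegrable_of_mem_Icc hn (by constructor <;> norm_num) (by simp)), hu']
  refine add_lt_add (lt_of_eq_of_lt ?_ hlt₁) hlt₂
  have e := intervalIntegral.smul_integral_comp_mul_add (a := 0) (b := 1 / 2)
    (fun s => ‖u₁ s‖) 2 0
  rw [show (2 : ℝ) * 0 + 0 = 0 by norm_num, show (2 : ℝ) * (1 / 2) + 0 = 1 by norm_num] at e
  rw [← e, smul_eq_mul, ← intervalIntegral.integral_const_mul]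
  refine intervalIntegral.integral_congr fun s hs => ?_
  rw [uIcc_of_le (by norm_num)] at hs
  simp only [huu hs, norm_smul, Real.norm_ofNat]

/-- The class in `L¹` of the control of a trajectory. -/
noncomputable def IsTrajectory.control {u : ℝ → Rn k} {γ : ℝ → Rn n}
    (h : IsTrajectory M X u γ 0 1) : Control k := Integrable.toL1 u h.integrableOn

theorem IsTrajectory.control_ae_eq {u : ℝ → Rn k} {γ : ℝ → Rn n}
    (h : IsTrajectory M X u γ 0 1) :
    h.control =ᵐ[volume.restrict (Icc (0 : ℝ) 1)] u := Integrable.coeFn_toL1 _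

theorem IsTrajectory.isControlledCurve (hX : ∀ i, ContDiffOn ℝ ∞ (X i) M) {u : ℝ → Rn k}
    {γ : ℝ → Rn n} (h : IsTrajectory M X u γ 0 1) : IsControlledCurve M X h.control (γ 0) γ := by
  refine (isControlledCurve_iff hX).2 ⟨rfl, control_integrableOn _, h.continuousOn, h.mem,
    fun s hs t ht => ?_⟩
  rw [← h.integral_eq s hs t ht]
  refine intervalIntegral.integral_congr_ae ?_
  filter_upwards [ae_of_ae_restrict_Icc h.control_ae_eq hs ht] with r hr hrst
  rw [hr hrst]

theorem reach_endMap (hX : ∀ i, ContDiffOn ℝ ∞ (X i) M)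
    (hlip : ∃ L : ℝ, ∀ i, ∀ x ∈ M, ∀ y ∈ M, ‖X i x - X i y‖ ≤ L * ‖x - y‖) {x : Rn n}
    {u : Control k} (hu : u ∈ endDomain M X x) {ε : ℝ} (hε : ‖u‖ < ε) :
    Reach M X ε x (endMap M X x u) := by
  obtain ⟨γ, hγ⟩ := hu
  obtain ⟨h0, h⟩ := (isControlledCurve_iff hX).1 hγ
  exact ⟨u, γ, h, h0, (endMap_eq hX hlip hγ).symm, by rwa [← norm_control_eq]⟩

/-- Whatever can be reached from the endpoint of `u` by a sufficiently short control is the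
endpoint of a control close to `u`: the end of the time interval is used to run through the
rest of the curve of `u` and then through the additional curve. -/
theorem exists_forall_reach_mem_image_endMap (hX : ∀ i, ContDiffOn ℝ ∞ (X i) M)
    (hlip : ∃ L : ℝ, ∀ i, ∀ x ∈ M, ∀ y ∈ M, ‖X i x - X i y‖ ≤ L * ‖x - y‖) {x : Rn n}
    {u : Control k} (hu : u ∈ endDomain M X x) {W : Set (Control k)} (hW : W ∈ 𝓝 u) :
    ∃ δ > 0, ∀ z, Reach M X δ (endMap M X x u) z → z ∈ endMap M X x '' W := by
  obtain ⟨ε, hε, hball⟩ := Metric.mem_nhds_iff.1 hW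
  obtain ⟨γ, hγ⟩ := hu
  obtain ⟨h0, h⟩ := (isControlledCurve_iff hX).1 hγ
  have hun : IntegrableOn (fun s => ‖u s‖) (Icc 0 1) := h.integrableOn.norm
  obtain ⟨τ, hτ1, hτ⟩ : ∃ τ, (∫ s in τ..1, ‖u s‖) < ε / 4 ∧ τ ∈ Ioo (0 : ℝ) 1 := by
    exact (((tendsto_integral_tail hun).eventually (gt_mem_nhds (by positivity : 0 < ε / 4))).and
      (Ioo_mem_nhdsLT zero_lt_one)).exists
  have hτ' : τ ∈ Ico (0 : ℝ) 1 := Ioo_subset_Ico_self hτ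
  refine ⟨ε / 4, by positivity, fun z hz => ?_⟩
  rw [endMap_eq hX hlip hγ] at hz
  obtain ⟨u₂, γ₂, hu₂, hy, rfl, hlt⟩ := (Reach.of_tail h hτ' hτ1).trans hX hz
  obtain ⟨v, ζ, hv, hζ0, hζ1, hvu, hvn⟩ := (h.mono (Icc_subset_Icc le_rfl hτ.2.le)).exists_splice
    hX hτ' hu₂ hy.symm
  have hc := hv.isControlledCurve hX
  rw [hζ0, h0] at hc
  refine ⟨hv.control, hball ?_, (endMap_eq hX hlip hc).trans hζ1⟩
  rw [mem_ball_iff_norm, norm_control_eq]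
  have m0 : (0 : ℝ) ∈ Icc (0 : ℝ) 1 := left_mem_Icc.2 zero_le_one
  have m1 : (1 : ℝ) ∈ Icc (0 : ℝ) 1 := right_mem_Icc.2 zero_le_one
  have mτ : τ ∈ Icc (0 : ℝ) 1 := Ioo_subset_Icc_self hτ
  have hvnorm : IntegrableOn (fun s => ‖v s‖) (Icc 0 1) := hv.integrableOn.norm
  have hdn : IntegrableOn (fun s => ‖v s - u s‖) (Icc 0 1) :=
    (hv.integrableOn.sub h.integrableOn).norm
  have e1 : ∫ s in (0 : ℝ)..1, ‖(hv.control - u : Control k) s‖ =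
      ∫ s in (0 : ℝ)..1, ‖v s - u s‖ := by
    refine intervalIntegral.integral_congr_ae ?_
    filter_upwards [ae_of_ae_restrict_Icc (Lp.coeFn_sub hv.control u) m0 m1,
      ae_of_ae_restrict_Icc hv.control_ae_eq m0 m1] with s hs1 hs2 hs
    rw [hs1 hs, Pi.sub_apply, hs2 hs]
  have e2 : ∫ s in (0 : ℝ)..τ, ‖v s - u s‖ = 0 := by
    refine (intervalIntegral.integral_congr (g := fun _ => 0) fun s hs => ?_).trans (by simp)
    rw [uIcc_of_le hτ.1.le] at hs
    simp only [hvu hs, sub_self, norm_zero]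
  rw [e1, ← intervalIntegral.integral_add_adjacent_intervals
    (intervalIntegrable_of_mem_Icc hdn m0 mτ) (intervalIntegrable_of_mem_Icc hdn mτ m1), e2,
    zero_add]
  have i1 := intervalIntegrable_of_mem_Icc hvnorm mτ m1
  have i2 := intervalIntegrable_of_mem_Icc hun mτ m1
  calc ∫ s in τ..1, ‖v s - u s‖ ≤ ∫ s in τ..1, (‖v s‖ + ‖u s‖) :=
        intervalIntegral.integral_mono_on hτ.2.le (intervalIntegrable_of_mem_Icc hdn mτ m1)
          (i1.add i2) fun s _ => norm_sub_le _ _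
    _ = (∫ s in τ..1, ‖v s‖) + ∫ s in τ..1, ‖u s‖ := intervalIntegral.integral_add i1 i2
    _ < ε := by rw [hvn]; linarith

/-- Local form of the Chow–Rashevskii theorem: all points near `y` can be reached from `y` by short
controls. Near a control `w` of full rank the endpoint map from `y` is onto a neighborhood of its
endpoint; by continuity `w` steers all points `y'` near `y` into that neighborhood, and reversing
the curve from `y'` closes the connection. -/
theorem eventually_reach (hMo : IsOpen M) (hX : ∀ i, ContDiffOn ℝ ∞ (X i) M)
    (hlip : ∃ L : ℝ, ∀ i, ∀ x ∈ M, ∀ y ∈ M, ‖X i x - X i y‖ ≤ L * ‖x - y‖)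
    {H : Rn n → Submodule ℝ (Rn n)}
    (hspan : ∀ x ∈ M, H x = Submodule.span ℝ (range fun i => X i x))
    (hH : IsBracketGenerating M H) {y : Rn n} (hy : y ∈ M) {δ : ℝ} (hδ : 0 < δ) :
    ∀ᶠ z in 𝓝 y, Reach M X δ y z := by
  let U : Set (Control k) := Metric.ball 0 (δ / 2) ∩ endDomain M X y
  have hU : IsOpen U := Metric.isOpen_ball.inter (isOpen_endDomain hMo hX y)
  obtain ⟨w, hw, hsurj⟩ := exists_range_fderiv_endMap_eq_top hMo hX hlip hspan hH hU
    ⟨0, Metric.mem_ball_self (half_pos hδ), zero_mem_endDomain hX hy⟩ inter_subset_right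
  have hN : endMap M X y '' U ∈ 𝓝 (endMap M X y w) := by
    have hs := (contDiffAt_endMap hMo hX hlip hw.2).hasStrictFDerivAt (by simp)
    rw [← hs.map_nhds_eq_of_surj hsurj]
    exact image_mem_map (hU.mem_nhds hw)
  filter_upwards [eventually_mem_endDomain_and_endMap_mem hMo hX hlip hw.2 hN] with z hz
  obtain ⟨hzD, v, hv, he⟩ := hz
  have h1 := reach_endMap hX hlip hv.2 (mem_ball_zero_iff.1 hv.1)
  have h2 := (reach_endMap hX hlip hzD (mem_ball_zero_iff.1 hw.1)).symm
  rw [he] at h1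
  simpa using h1.trans hX h2

theorem isOpen_image_endMap (hMo : IsOpen M) (hX : ∀ i, ContDiffOn ℝ ∞ (X i) M)
    (hlip : ∃ L : ℝ, ∀ i, ∀ x ∈ M, ∀ y ∈ M, ‖X i x - X i y‖ ≤ L * ‖x - y‖)
    {H : Rn n → Submodule ℝ (Rn n)}
    (hspan : ∀ x ∈ M, H x = Submodule.span ℝ (range fun i => X i x))
    (hH : IsBracketGenerating M H) {x : Rn n} {W : Set (Control k)} (hW : IsOpen W)
    (hWD : W ⊆ endDomain M X x) : IsOpen (endMap M X x '' W) := by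
  refine isOpen_iff_mem_nhds.2 ?_
  rintro _ ⟨u, hu, rfl⟩
  obtain ⟨δ, hδ, h⟩ := exists_forall_reach_mem_image_endMap hX hlip (hWD hu) (hW.mem_nhds hu)
  filter_upwards [eventually_reach hMo hX hlip hspan hH (endMap_mem (hWD hu)) hδ] with z hz
  exact h z hz

end Concatenation

end SubRiem

theorem mainTheorem3 (n k : ℕ) (M : Set (SubRiem.Rn n)) (hMo : IsOpen M) (hMc : IsConnected M)
    (X : Fin k → SubRiem.Rn n → SubRiem.Rn n)
    (hX : ∀ i, ContDiffOn ℝ ∞ (X i) M)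
    (hbdd : ∃ K : ℝ, ∀ i, ∀ x ∈ M, ‖X i x‖ ≤ K)
    (hlip : ∃ L : ℝ, ∀ i, ∀ x ∈ M, ∀ y ∈ M, ‖X i x - X i y‖ ≤ L * ‖x - y‖)
    (H : SubRiem.Rn n → Submodule ℝ (SubRiem.Rn n))
    (hspan : ∀ x ∈ M, H x = Submodule.span ℝ (Set.range fun i => X i x))
    (hH : SubRiem.IsBracketGenerating M H)
    (x : SubRiem.Rn n) (hx : x ∈ M) :
    -- the endpoint map is well defined, with an open domain containing the zero control
    IsOpen (SubRiem.endDomain M X x) ∧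
    (0 : SubRiem.Control k) ∈ SubRiem.endDomain M X x ∧
    (∀ u γ γ', SubRiem.IsControlledCurve M X u x γ → SubRiem.IsControlledCurve M X u x γ' →
      Set.EqOn γ γ' (Set.Icc 0 1)) ∧
    -- it is differentiable, so that its rank makes sense
    (∀ u ∈ SubRiem.endDomain M X x, DifferentiableAt ℝ (SubRiem.endMap M X x) u) ∧
    -- on the whole domain, and on each smaller open domain that contains the zero control,
    -- it is an open map and its maximal rank is the dimension of `M`
    (∀ U : Set (SubRiem.Control k), IsOpen U → 0 ∈ U → U ⊆ SubRiem.endDomain M X x →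
      IsOpenMap (U.domRestrict (SubRiem.endMap M X x)) ∧
      IsGreatest (SubRiem.rankAt (SubRiem.endMap M X x) '' U) n) := by
  refine ⟨SubRiem.isOpen_endDomain hMo hX x, SubRiem.zero_mem_endDomain hX hx,
    fun u γ γ' h h' => SubRiem.isControlledCurve_eqOn hX hlip h h',
    fun u hu => (SubRiem.contDiffAt_endMap hMo hX hlip hu).differentiableAt (by simp),
    fun U hU h0 hUD => ⟨?_, ?_, ?_⟩⟩
  · intro O hO
    have himg : U.domRestrict (SubRiem.endMap M X x) '' O =
        SubRiem.endMap M X x '' (Subtype.val '' O) := by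
      rw [Set.image_image]
      rfl
    rw [himg]
    refine SubRiem.isOpen_image_endMap hMo hX hlip hspan hH (hU.isOpenMap_subtype_val O hO) ?_
    rintro _ ⟨u, -, rfl⟩
    exact hUD u.2
  · obtain ⟨u, hu, hr⟩ := SubRiem.exists_range_fderiv_endMap_eq_top hMo hX hlip hspan hH hU
      ⟨0, h0⟩ hUD
    refine ⟨u, hu, ?_⟩
    rw [SubRiem.rankAt, hr, finrank_top, finrank_euclideanSpace_fin]
  · rintro _ ⟨u, -, rfl⟩
    exact SubRiem.rankAt_le _ u
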